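/- \textbf{Notation.} Let $\mathcal{P}_f(\mathbb{N})$ be the set of non-empty finite subsets of $\mathbb{N}$; write $\alpha<\beta$ if $\max\alpha<\min\beta$. Let $\mathbb{E}$ be the family of all $V\subseteq\mathcal{P}_f(\mathbb{N})$ such that for some $\beta\in\mathcal{P}_f(\mathbb{N})$ every $\alpha>\beta$ belongs to $V$. Let $G$ be a group, with identity $1_G$; write $u^c=c^{-1}uc$ and $[u,c]=u^{-1}c^{-1}uc$, and apply these operations pointwise to maps into $G$. \textbf{Polynomial mappings.} For $x:\mathcal{P}_f(\mathbb{N})\to G$ put $D_\beta x(\alpha)=x(\alpha)^{-1}x(\alpha\cup\beta)x(\beta)^{-1}$. The map $x$ is an IP mapping if $x(\alpha\cup\beta)=x(\alpha)x(\beta)$ whenever $\alpha<\beta$. A map $P:\mathcal{P}_f(\mathbb{N})\to G$ is a polynomial mapping of degree $1$ if $\{\alpha:P(\alpha)=x(\alpha)\}\in\mathbb{E}$ for some IP mapping $x$, and, for $d>1$, a polynomial mapping of degree $d$ if $\{\beta: D_\beta P\text{ is a polynomial mapping of degree }d-1\}\in\mathbb{E}$. A polynomial mapping is a polynomial mapping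 of some degree $d\ge 1$. \textbf{Filters.} A (proper) filter $\mathcal{F}$ on $G$ is idempotent if for every $A\in\mathcal{F}$ one has $\{x\in G:\{y\in G: xy\in A\}\in\mathcal{F}\}\in\mathcal{F}$. A set $A\subseteq G$ is syndetic if $K^{-1}A=G$ for some non-empty finite $K\subseteq G$, where $K^{-1}A=\{k^{-1}a:k\in K,a\in A\}$. It is $\mathcal{F}$-syndetic if for every $V\in\mathcal{F}$ there is a non-empty finite $K\subseteq V$ with $K^{-1}A\in\mathcal{F}$. Let $\overline{\mathcal{F}}$ be the set of ultrafilters on $G$ that extend $\mathcal{F}$; for idempotent $\mathcal{F}$ it is a compact semigroup under the product given by $A\in p\cdot q\Leftrightarrow\{x:\{y:xy\in A\}\in q\}\in p$. The set $A$ is piecewise $\mathcal{F}$-syndetic if $A$ belongs to some ultrafilter in the smallest two-sided ideal of $\overline{\mathcal{F}}$. \textbf{Good collections.} A map $x:\mathcal{P}_f(\mathbb{N})\to G$ is $\mathcal{F}$-measurable if $x^{-1}(V\cup\{1_G\})\in\mathbb{E}$ for all $V\in\mathcal{F}$. A set $\mathscr{P}$ of polynomial mappings $\mathcal{P}_f(\mathbb{N})\to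 G$ is a good collection of $\mathcal{F}$-measurable polynomial mappings if (I) the constant map $1_G$ belongs to $\mathscr{P}$; (II) every $P\in\mathscr{P}$ is $\mathcal{F}$-measurable; (III) for all $R,P\in\mathscr{P}$, $\{c\in G: R^c[c,P]\in\mathscr{P}\}\in\mathcal{F}$; (IV) for all $R,P\in\mathscr{P}$ there are $C\in\mathcal{F}$ and $\mathcal{T}\in\mathbb{E}$ such that $(R\,D_\beta P)^c\in\mathscr{P}$ for all $c\in C$ and $\beta\in\mathcal{T}$. \textbf{Theorem (Nilpotent PHJ).} Let $G$ be a nilpotent group. (1) Let $\mathcal{F}$ be an idempotent filter on $G$ and $\mathscr{P}$ a good collection of $\mathcal{F}$-measurable polynomial mappings. Then for all $P_1,\dots,P_k\in\mathscr{P}$ and every set $A\subseteq G$ that is $\mathcal{F}$-syndetic or piecewise $\mathcal{F}$-syndetic, there are $\alpha\in\mathcal{P}_f(\mathbb{N})$ and $a\in G$ such that $\{P_1(\alpha)a,\dots,P_k(\alpha)a\}\subseteq A$. (2) In particular (trivial filter $\mathcal{F}=\{G\}$), for all polynomial mappings $P_1,\dots,P_k:\mathcal{P}_f(\mathbb{N})\to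 G$ and every syndetic set $A\subseteq G$ there are $\alpha\in\mathcal{P}_f(\mathbb{N})$ and $a\in G$ such that $\{P_1(\alpha)a,\dots,P_k(\alpha)a\}\subseteq A$. -/

import Mathlib

namespace NilpotentPHJ

open scoped Pointwise

/-- The non-empty finite subsets of `ℕ`. -/
abbrev FinSets : Type := {α : Finset ℕ // α.Nonempty}

/-- The union of two non-empty finite subsets of `ℕ`. -/
def FinSets.union (α β : FinSets) : FinSets :=
  ⟨α.1 ∪ β.1, α.2.mono Finset.subset_union_left⟩

/-- `α < β` in the sense of `max α < min β`. -/
def FinSets.Before (α β : FinSets) : Prop :=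
  α.1.max' α.2 < β.1.min' β.2

theorem FinSets.Before.of_union_left {α β γ : FinSets}
    (h : FinSets.Before (FinSets.union α β) γ) : FinSets.Before α γ :=
  lt_of_le_of_lt (Finset.max'_subset α.2 Finset.subset_union_left) h

theorem FinSets.Before.of_union_right {α β γ : FinSets}
    (h : FinSets.Before (FinSets.union α β) γ) : FinSets.Before β γ :=
  lt_of_le_of_lt (Finset.max'_subset β.2 Finset.subset_union_right) h

/-- The filter `𝔼` on the non-empty finite subsets of `ℕ`: a set `V` belongs to it if and only if
there is some `β` such that every `α > β` lies in `V`. -/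
def eventually : Filter FinSets where
  sets := {V | ∃ β : FinSets, {α : FinSets | FinSets.Before β α} ⊆ V}
  univ_sets := ⟨⟨{0}, Finset.singleton_nonempty 0⟩, Set.subset_univ _⟩
  sets_of_superset := fun ⟨β, hβ⟩ hVW => ⟨β, hβ.trans hVW⟩
  inter_sets := fun ⟨β, hβ⟩ ⟨γ, hγ⟩ =>
    ⟨FinSets.union β γ, fun _ hα => ⟨hβ hα.of_union_left, hγ hα.of_union_right⟩⟩

variable {G : Type*} [Group G]

/-- IP mappings: `x (α ∪ β) = x α * x β` whenever `α < β`. -/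
def IsIPMap (x : FinSets → G) : Prop :=
  ∀ α β : FinSets, FinSets.Before α β → x (FinSets.union α β) = x α * x β

/-- The discrete derivative of `x` in direction `β`. -/
def deriv (β : FinSets) (x : FinSets → G) : FinSets → G :=
  fun α => (x α)⁻¹ * x (FinSets.union α β) * (x β)⁻¹

/-- `IsPolyOfDegree d P`: `P` is a polynomial mapping of degree `d`. Degrees are positive integers,
so nothing is a polynomial mapping "of degree `0`" here (constant `1` has degree `1`). -/
def IsPolyOfDegree : ℕ → (FinSets → G) → Prop
  | 0, _ => False
  | 1, P => ∃ x : FinSets → G, IsIPMap x ∧ {α | P α = x α} ∈ eventually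
  | d + 2, P => {β | IsPolyOfDegree (d + 1) (deriv β P)} ∈ eventually

/-- `P` is a polynomial mapping (of some degree `d ≥ 1`). -/
def IsPoly (P : FinSets → G) : Prop := ∃ d : ℕ, 1 ≤ d ∧ IsPolyOfDegree d P

/-- The product of two filters: `A` belongs to it if and only if
`{x | {y | x * y ∈ A} ∈ F₂} ∈ F₁`. This is not the elementwise product of filters of Mathlib. -/
def filterProd (F₁ F₂ : Filter G) : Filter G where
  sets := {A | {x | {y | x * y ∈ A} ∈ F₂} ∈ F₁}
  univ_sets := by simp
  sets_of_superset := fun {A B} hA hAB =>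
    Filter.mem_of_superset hA fun _ hx => Filter.mem_of_superset hx fun _ hy => hAB hy
  inter_sets := fun {A B} hA hB =>
    Filter.mem_of_superset (Filter.inter_mem hA hB) fun _ hx => Filter.inter_mem hx.1 hx.2

/-- A filter `F` is idempotent if the family `F · F` contains the family `F`. -/
def IsIdempotentFilter (F : Filter G) : Prop :=
  ∀ A : Set G, A ∈ F → A ∈ filterProd F F

/-- `A` is syndetic if `K⁻¹ A = G` for some non-empty finite set `K`. -/
def IsSyndetic (A : Set G) : Prop :=
  ∃ K : Finset G, K.Nonempty ∧ (K : Set G)⁻¹ * A = Set.univ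

/-- `A` is `F`-syndetic if for all `V ∈ F` there is a non-empty finite `K ⊆ V` with `K⁻¹ A ∈ F`. -/
def IsFilterSyndetic (F : Filter G) (A : Set G) : Prop :=
  ∀ V ∈ F, ∃ K : Finset G, K.Nonempty ∧ (K : Set G) ⊆ V ∧ (K : Set G)⁻¹ * A ∈ F

/-- The closure of the filter `F`: the set of all ultrafilters that extend `F`. -/
def filterClosure (F : Filter G) : Set (Ultrafilter G) := {p | ∀ A ∈ F, A ∈ p}

section Ideal

attribute [local instance] Ultrafilter.mul

/-- `I` is a (non-empty) two-sided ideal of `T`, a set of ultrafilters on `G`, with respect to the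
product of ultrafilters `A ∈ p * q ↔ {x | {y | x * y ∈ A} ∈ q} ∈ p`. -/
def IsTwoSidedIdeal (T I : Set (Ultrafilter G)) : Prop :=
  I.Nonempty ∧ I ⊆ T ∧ ∀ p ∈ T, ∀ q ∈ I, p * q ∈ I ∧ q * p ∈ I

theorem mem_ultrafilter_mul (p q : Ultrafilter G) (A : Set G) :
    A ∈ p * q ↔ {x | {y | x * y ∈ A} ∈ q} ∈ p :=
  Ultrafilter.eventually_mul p q (· ∈ A)

end Ideal

/-- The smallest two-sided ideal `K(T)` of `T`, as the intersection of all two-sided ideals. -/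
def smallestIdeal (T : Set (Ultrafilter G)) : Set (Ultrafilter G) :=
  {p | p ∈ T ∧ ∀ I : Set (Ultrafilter G), IsTwoSidedIdeal T I → p ∈ I}

/-- `A` is piecewise `F`-syndetic if it belongs to some ultrafilter in the smallest ideal of the
closure of `F`. -/
def IsPiecewiseFilterSyndetic (F : Filter G) (A : Set G) : Prop :=
  ∃ p ∈ smallestIdeal (filterClosure F), A ∈ p

/-- `x` is `F`-measurable if `x⁻¹(V ∪ {1}) ∈ 𝔼` for all `V ∈ F`. -/
def IsFilterMeasurable (F : Filter G) (x : FinSets → G) : Prop :=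
  ∀ V ∈ F, x ⁻¹' (V ∪ {1}) ∈ eventually

/-- Conjugate `u ^ c = c⁻¹ u c`. -/
def conj (u c : G) : G := c⁻¹ * u * c

/-- Commutator `[u, c] = u⁻¹ c⁻¹ u c`. -/
def comm (u c : G) : G := u⁻¹ * c⁻¹ * u * c

/-- Good collections of `F`-measurable polynomial mappings. -/
structure IsGoodCollection (F : Filter G) (Ps : Set (FinSets → G)) : Prop where
  isPoly : ∀ P ∈ Ps, IsPoly P
  one_mem : (fun _ => 1) ∈ Ps
  measurable : ∀ P ∈ Ps, IsFilterMeasurable F P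
  conj_comm_mem : ∀ R ∈ Ps, ∀ P ∈ Ps,
    {c : G | (fun α => conj (R α) c * comm c (P α)) ∈ Ps} ∈ F
  conj_deriv_mem : ∀ R ∈ Ps, ∀ P ∈ Ps, ∃ C ∈ F, ∃ T ∈ eventually,
    ∀ c ∈ C, ∀ β ∈ T, (fun α => conj (R α * deriv β P α) c) ∈ Ps

end NilpotentPHJ

/-! The proof combines colour focusing with an induction on weights (PET induction), carried out at
an ultrafilter `p` in a minimal left ideal of the closure of `F`. Both notions of largeness provide
such a `p` containing `A`. It then suffices to bring all `P α * h` into `returnSet p A`, since `P α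
* h * y ∈ A` for `p`-most `y`.

Two properties of finite systems feed each other. By minimality, finitely many translates of
`returnSet p A` cover a member of `F`, and so define a finite colouring; a monochromatic
configuration of the twisted system of all `R ^ k [k, P₀]` yields returns for the original one
(`hasReturns_of_hasMonochromatic`, the use of axiom III). Conversely, focusing yields monochromatic
configurations from returns for the systems of focus maps (`hasMonochromatic_of_step`, the use of
axiom IV).

Nilpotency makes this circle well-founded. Relative to a stretched lower central series, mappings
form decreasing groups `L k`, ending with the eventually trivial ones, in which derivatives and
commutators gain a level. Modulo the next level, twisting does not change `P * P₀⁻¹`, while passing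
to focus maps divides it by `P₁ * P₀⁻¹`. If the latter has the highest level that occurs, one class
disappears there and no lower level gains classes, so the lexicographic weight drops. -/

namespace NilpotentPHJ

/-! ### The filter `eventually` -/

/-- The non-empty finite sets of natural numbers all of whose elements are at least `n`. -/
def tail (n : ℕ) : Set FinSets := {α | ∀ x ∈ α.1, n ≤ x}

theorem tail_antitone {m n : ℕ} (h : m ≤ n) : tail n ⊆ tail m :=
  fun _ hα x hx => h.trans (hα x hx)

theorem union_mem_tail {n : ℕ} {α β : FinSets} (hα : α ∈ tail n) (hβ : β ∈ tail n) :
    FinSets.union α β ∈ tail n := fun x hx =>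
  (Finset.mem_union.1 hx).elim (hα x) (hβ x)

theorem tail_nonempty (n : ℕ) : (tail n).Nonempty :=
  ⟨⟨{n}, Finset.singleton_nonempty n⟩, fun _ hx => (Finset.mem_singleton.1 hx).ge⟩

theorem mem_eventually_iff {V : Set FinSets} : V ∈ eventually ↔ ∃ n, tail n ⊆ V := by
  constructor
  · rintro ⟨β, hβ⟩
    refine ⟨β.1.max' β.2 + 1, fun α hα => hβ ?_⟩
    exact Nat.lt_of_succ_le (hα _ (Finset.min'_mem _ _))
  · rintro ⟨n, hn⟩
    refine ⟨⟨{n}, Finset.singleton_nonempty n⟩, fun α hα => hn fun x hx => ?_⟩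
    have h : n < α.1.min' α.2 := hα
    exact h.le.trans (Finset.min'_le _ _ hx)

theorem tail_mem_eventually (n : ℕ) : tail n ∈ eventually := mem_eventually_iff.2 ⟨n, subset_rfl⟩

theorem eventually_iff_exists {p : FinSets → Prop} :
    (∀ᶠ α in eventually, p α) ↔ ∃ n, ∀ α ∈ tail n, p α := mem_eventually_iff

instance : eventually.NeBot := ⟨fun h => by
  obtain ⟨n, hn⟩ := mem_eventually_iff.1 (Filter.empty_mem_iff_bot.2 h)
  exact (tail_nonempty n).elim fun _ hα => hn hα⟩

theorem eventually_union {p : FinSets → Prop} (h : ∀ᶠ α in eventually, p α) :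
    ∀ᶠ β in eventually, ∀ᶠ α in eventually, p (FinSets.union α β) := by
  obtain ⟨n, hn⟩ := eventually_iff_exists.1 h
  filter_upwards [tail_mem_eventually n] with β hβ
  filter_upwards [tail_mem_eventually n] with α hα using hn _ (union_mem_tail hα hβ)

theorem eventually_before (β : FinSets) : ∀ᶠ α in eventually, FinSets.Before β α :=
  ⟨β, subset_rfl⟩

theorem FinSets.union_comm (α β : FinSets) : FinSets.union α β = FinSets.union β α :=
  Subtype.ext (Finset.union_comm _ _)

universe u

variable {G : Type u} [Group G]

theorem deriv_congr {P Q : FinSets → G} (h : P =ᶠ[eventually] Q) :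
    ∀ᶠ β in eventually, deriv β P =ᶠ[eventually] deriv β Q := by
  filter_upwards [h, eventually_union h] with β hβ hu
  filter_upwards [h, hu] with α hα hαβ
  simp only [deriv, hα, hβ, hαβ]

/-! ### Polynomial mappings with respect to a filtration -/

/-- `HasLevel K m k Q`: for all `i < m` the `i`-th derivatives of `Q` eventually take values in
`K (k + i)`. -/
def HasLevel (K : ℕ → Subgroup G) : ℕ → ℕ → (FinSets → G) → Prop
  | 0, _, _ => True
  | m + 1, k, Q => (∀ᶠ α in eventually, Q α ∈ K k) ∧
      ∀ᶠ β in eventually, HasLevel K m (k + 1) (deriv β Q)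

theorem HasLevel.congr {K : ℕ → Subgroup G} {m k : ℕ} {P Q : FinSets → G} (h : HasLevel K m k P)
    (hPQ : P =ᶠ[eventually] Q) : HasLevel K m k Q := by
  induction m generalizing k P Q with
  | zero => trivial
  | succ m ih =>
    refine ⟨?_, ?_⟩
    · filter_upwards [h.1, hPQ] with α h₁ h₂ using h₂ ▸ h₁
    · filter_upwards [h.2, deriv_congr hPQ] with β h₁ h₂ using ih h₁ h₂

theorem hasLevel_one (K : ℕ → Subgroup G) (m k : ℕ) : HasLevel K m k (1 : FinSets → G) := by
  induction m generalizing k with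
  | zero => trivial
  | succ m ih =>
    refine ⟨.of_forall fun _ => one_mem _, .of_forall fun β => (ih (k + 1)).congr (.of_forall ?_)⟩
    intro α
    simp [deriv]

theorem HasLevel.pred {K : ℕ → Subgroup G} {m k : ℕ} {Q : FinSets → G}
    (h : HasLevel K (m + 1) k Q) : HasLevel K m k Q := by
  induction m generalizing k Q with
  | zero => trivial
  | succ m ih => exact ⟨h.1, h.2.mono fun β hβ => ih hβ⟩

theorem HasLevel.anti {K : ℕ → Subgroup G} (hK : Antitone K) {m k l : ℕ} (hkl : k ≤ l)
    {Q : FinSets → G} (h : HasLevel K m l Q) : HasLevel K m k Q := by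
  induction m generalizing k l Q with
  | zero => trivial
  | succ m ih =>
    exact ⟨h.1.mono fun α hα => hK hkl hα, h.2.mono fun β hβ => ih (Nat.succ_le_succ hkl) hβ⟩

/-- A filtration of a group by subgroups, indexed so that `⁅K i, K j⁆ ≤ K (i + j + 1)`. -/
structure IsCommFiltration (K : ℕ → Subgroup G) : Prop where
  zero : K 0 = ⊤
  anti : Antitone K
  comm_mem : ∀ i j, ∀ x ∈ K i, ∀ y ∈ K j, comm x y ∈ K (i + j + 1)

/-- The set of mappings of level `k`, up to the derivatives of order `m`, is closed under the
operations of a group and under commutators. -/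
structure LevelClosed (K : ℕ → Subgroup G) (m : ℕ) : Prop where
  mul : ∀ k P Q, HasLevel K m k P → HasLevel K m k Q → HasLevel K m k (P * Q)
  inv : ∀ k P, HasLevel K m k P → HasLevel K m k P⁻¹
  comm_const : ∀ i j Q g, HasLevel K m i Q → g ∈ K j →
    HasLevel K m (i + j + 1) (comm Q (Function.const _ g))
  comm : ∀ i j Q R, HasLevel K m i Q → HasLevel K m j R → HasLevel K m (i + j) (comm Q R)

theorem conj_eq_mul_comm {H : Type*} [Group H] (u c : H) : conj u c = u * comm u c := by
  simp only [conj, comm]; group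

theorem comm_swap {H : Type*} [Group H] (u c : H) : comm u c = (comm c u)⁻¹ := by
  simp only [comm]; group

/-! ### Closure under the group operations: one more derivative. -/

section Step

variable {K : ℕ → Subgroup G} {m : ℕ}

theorem LevelClosed.conj_const (h : LevelClosed K m) (hK : IsCommFiltration K) {k : ℕ}
    {Q : FinSets → G} (hQ : HasLevel K m k Q) (g : G) :
    HasLevel K m k (conj Q (Function.const _ g)) := by
  rw [conj_eq_mul_comm]
  refine h.mul _ _ _ hQ ((h.comm_const k 0 Q g hQ ?_).anti hK.anti (by omega))
  simp [hK.zero]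

theorem LevelClosed.conj (h : LevelClosed K m) (hK : IsCommFiltration K) {k j : ℕ}
    {Q R : FinSets → G} (hQ : HasLevel K m k Q) (hR : HasLevel K m j R) :
    HasLevel K m k (conj Q R) := by
  rw [conj_eq_mul_comm]
  exact h.mul _ _ _ hQ ((h.comm k j Q R hQ hR).anti hK.anti (by omega))

/-- A noncommutative product rule: up to conjugation, the derivative of `P * Q` consists of the two
derivatives and a commutator of `Q` with the constant `(P β)⁻¹`. Each factor needs only the closure
properties for `m`. -/
theorem LevelClosed.mul_succ (h : LevelClosed K m) (hK : IsCommFiltration K) {k : ℕ}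
    {P Q : FinSets → G} (hP : HasLevel K (m + 1) k P) (hQ : HasLevel K (m + 1) k Q) :
    HasLevel K (m + 1) k (P * Q) := by
  refine ⟨?_, ?_⟩
  · filter_upwards [hP.1, hQ.1] with α h₁ h₂ using mul_mem h₁ h₂
  · filter_upwards [hP.1, hP.2, hQ.2] with β h₁ h₂ h₃
    have key : deriv β (P * Q) = NilpotentPHJ.conj (deriv β P) Q *
        NilpotentPHJ.comm Q (Function.const _ (P β)⁻¹) *
        NilpotentPHJ.conj (deriv β Q) (Function.const _ (P β)⁻¹) := by
      ext α
      simp only [deriv, NilpotentPHJ.conj, NilpotentPHJ.comm, Pi.mul_apply, Pi.inv_apply,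
        Function.const_apply]
      group
    rw [key]
    refine h.mul _ _ _ (h.mul _ _ _ (h.conj hK h₂ hQ.pred) ?_) (h.conj_const hK h₃ _)
    exact (h.comm_const k k _ _ hQ.pred (inv_mem h₁)).anti hK.anti (by omega)

theorem LevelClosed.inv_succ (h : LevelClosed K m) (hK : IsCommFiltration K) {k : ℕ}
    {P : FinSets → G} (hP : HasLevel K (m + 1) k P) : HasLevel K (m + 1) k P⁻¹ := by
  refine ⟨?_, ?_⟩
  · filter_upwards [hP.1] with α h₁ using inv_mem h₁
  · filter_upwards [hP.1, hP.2] with β h₁ h₂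
    have key : deriv β P⁻¹ = NilpotentPHJ.comm P⁻¹ (Function.const _ (P β)) *
        NilpotentPHJ.conj (NilpotentPHJ.conj (deriv β P)⁻¹ P⁻¹) (Function.const _ (P β)) := by
      ext α
      simp only [deriv, NilpotentPHJ.conj, NilpotentPHJ.comm, Pi.mul_apply, Pi.inv_apply,
        Function.const_apply]
      group
    rw [key]
    have hi : HasLevel K m k P⁻¹ := h.inv _ _ hP.pred
    refine h.mul _ _ _ ((h.comm_const k k _ _ hi h₁).anti hK.anti (by omega)) ?_
    exact h.conj_const hK (h.conj hK (h.inv _ _ h₂) hi) _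

theorem LevelClosed.comm_const_succ (h : LevelClosed K m) (hK : IsCommFiltration K) {i j : ℕ}
    {Q : FinSets → G} {g : G} (hQ : HasLevel K (m + 1) i Q) (hg : g ∈ K j) :
    HasLevel K (m + 1) (i + j + 1) (NilpotentPHJ.comm Q (Function.const _ g)) := by
  refine ⟨?_, ?_⟩
  · filter_upwards [hQ.1] with α h₁ using hK.comm_mem i j _ h₁ _ hg
  · filter_upwards [hQ.1, hQ.2] with β h₁ h₂
    have key : deriv β (NilpotentPHJ.comm Q (Function.const _ g)) =
        NilpotentPHJ.comm (NilpotentPHJ.comm Q (Function.const _ g)) (Function.const _ (Q β)) *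
        NilpotentPHJ.conj (NilpotentPHJ.comm (NilpotentPHJ.comm Q (Function.const _ g)) (deriv β Q)
          * NilpotentPHJ.comm (deriv β Q) (Function.const _ g)) (Function.const _ (Q β)) := by
      ext α
      simp only [deriv, NilpotentPHJ.conj, NilpotentPHJ.comm, Pi.mul_apply, Pi.inv_apply,
        Function.const_apply]
      group
    rw [key]
    have hZ := h.comm_const i j Q g hQ.pred hg
    refine h.mul _ _ _ ((h.comm_const _ i _ _ hZ h₁).anti hK.anti (by omega))
      (h.conj_const hK (h.mul _ _ _ ?_ ?_) _)
    · exact (h.comm _ _ _ _ hZ h₂).anti hK.anti (by omega)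
    · exact (h.comm_const (i + 1) j _ _ h₂ hg).anti hK.anti (by omega)

/-- The values lie in `K (i + j + 1)`, but the level is only `i + j`: the derivative contains
commutators of `R` with the constant `Q β ∈ K i`, for which only level `i + j + 1` is available. -/
theorem LevelClosed.comm_succ (h : LevelClosed K m) (hK : IsCommFiltration K) {i j : ℕ}
    {Q R : FinSets → G} (hQ : HasLevel K (m + 1) i Q) (hR : HasLevel K (m + 1) j R) :
    HasLevel K (m + 1) (i + j) (NilpotentPHJ.comm Q R) := by
  refine ⟨?_, ?_⟩
  · filter_upwards [hQ.1, hR.1] with α h₁ h₂ using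
      hK.anti (by omega) (hK.comm_mem i j _ h₁ _ h₂)
  · filter_upwards [hQ.1, hQ.2, hR.1, hR.2] with β hq hD hr hE
    set Z := NilpotentPHJ.comm Q R with hZdef
    set D := deriv β Q with hDdef
    set E := deriv β R with hEdef
    set q : FinSets → G := Function.const _ (Q β) with hqdef
    set r : FinSets → G := Function.const _ (R β) with hrdef
    -- This expands the commutator of `Q (α ∪ β) = Q * D * q` and `R (α ∪ β) = R * E * r`; the
    -- conjugator `r * (comm q r)⁻¹` comes from moving `(Z β)⁻¹` inwards.
    have key : deriv β Z =
        NilpotentPHJ.conj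
          (NilpotentPHJ.conj (NilpotentPHJ.conj (NilpotentPHJ.comm Q r) D *
              NilpotentPHJ.comm D r) q *
            NilpotentPHJ.conj (NilpotentPHJ.conj (NilpotentPHJ.conj (NilpotentPHJ.comm Q E) D *
              NilpotentPHJ.comm D E) q * NilpotentPHJ.comm q E)
              (r * (NilpotentPHJ.comm q r)⁻¹)) Z *
        (Z⁻¹ * NilpotentPHJ.conj (NilpotentPHJ.conj (NilpotentPHJ.conj (NilpotentPHJ.conj Z D) q) E)
          (r * (NilpotentPHJ.comm q r)⁻¹)) *
        NilpotentPHJ.conj (NilpotentPHJ.conj (NilpotentPHJ.conj (NilpotentPHJ.comm D R) q *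
          NilpotentPHJ.comm q R) E) (r * (NilpotentPHJ.comm q r)⁻¹) := by
      ext α
      simp only [hZdef, hDdef, hEdef, hqdef, hrdef, deriv, NilpotentPHJ.conj, NilpotentPHJ.comm,
        Pi.mul_apply, Pi.inv_apply, Function.const_apply]
      group
    have hs : r * (NilpotentPHJ.comm q r)⁻¹ =
      Function.const _ (R β * (NilpotentPHJ.comm (Q β) (R β))⁻¹) := rfl
    rw [key, hs]
    have hZ : HasLevel K m (i + j) Z := h.comm i j Q R hQ.pred hR.pred
    have hD₁ : HasLevel K m (i + 1) D := hD
    have hE₁ : HasLevel K m (j + 1) E := hE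
    have cc {X : FinSets → G} (g : G) (hX : HasLevel K m (i + j + 1) X) :
        HasLevel K m (i + j + 1) (NilpotentPHJ.conj X (Function.const _ g)) :=
      h.conj_const hK hX g
    -- `Z` itself lacks one level, but `Z⁻¹` times a conjugate of `Z` is a commutator up to
    -- conjugation; the nested conjugations are peeled off one at a time.
    have tr {X C : FinSets → G} (hX : HasLevel K m (i + j + 1) (Z⁻¹ * X))
        (hC : HasLevel K m (i + j + 1) (NilpotentPHJ.comm Z C))
        (hc : ∀ Y, HasLevel K m (i + j + 1) Y → HasLevel K m (i + j + 1) (NilpotentPHJ.conj Y C)) :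
        HasLevel K m (i + j + 1) (Z⁻¹ * NilpotentPHJ.conj X C) := by
      have : Z⁻¹ * NilpotentPHJ.conj X C =
          NilpotentPHJ.comm Z C * NilpotentPHJ.conj (Z⁻¹ * X) C := by
        simp only [NilpotentPHJ.conj, NilpotentPHJ.comm]; group
      rw [this]
      exact h.mul _ _ _ hC (hc _ hX)
    have hcc {X : FinSets → G} {l a b : ℕ} {g : G} (hX : HasLevel K m a X) (hg : g ∈ K b)
        (hl : l ≤ a + b + 1) : HasLevel K m l (NilpotentPHJ.comm X (Function.const _ g)) :=
      (h.comm_const a b X g hX hg).anti hK.anti hl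
    have hc₂ {X Y : FinSets → G} {a b l : ℕ} (hX : HasLevel K m a X) (hY : HasLevel K m b Y)
        (hl : l ≤ a + b) : HasLevel K m l (NilpotentPHJ.comm X Y) :=
      (h.comm a b X Y hX hY).anti hK.anti hl
    have htop (g : G) : g ∈ K 0 := hK.zero ▸ Subgroup.mem_top g
    refine h.mul _ _ _ (h.mul _ _ _ (h.conj hK (h.mul _ _ _ ?_ ?_) hZ) ?_) ?_
    · exact cc _ (h.mul _ _ _ (h.conj hK (hcc hQ.pred hr le_rfl) hD₁) (hcc hD₁ hr (by omega)))
    · refine cc _ (h.mul _ _ _ (cc _ (h.mul _ _ _ (h.conj hK (hc₂ hQ.pred hE₁ (by omega)) hD₁)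
        (hc₂ hD₁ hE₁ (by omega)))) ?_)
      rw [comm_swap]
      exact h.inv _ _ (hcc hE₁ hq (by omega))
    · refine tr (tr (tr (tr ?_ (hc₂ hZ hD₁ (by omega)) fun Y hY => h.conj hK hY hD₁)
        (hcc hZ hq (by omega)) fun Y hY => cc _ hY)
        (hc₂ hZ hE₁ (by omega)) fun Y hY => h.conj hK hY hE₁)
        (hcc hZ (htop _) le_rfl) fun Y hY => cc _ hY
      rw [inv_mul_cancel]
      exact hasLevel_one K m _
    · refine cc _ (h.conj hK (h.mul _ _ _ (cc _ (hc₂ hD₁ hR.pred (by omega))) ?_) hE₁)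
      rw [comm_swap]
      exact h.inv _ _ (hcc hR.pred hq (by omega))

end Step

theorem IsCommFiltration.levelClosed {K : ℕ → Subgroup G} (hK : IsCommFiltration K) (m : ℕ) :
    LevelClosed K m := by
  induction m with
  | zero =>
    exact ⟨fun _ _ _ _ _ => trivial, fun _ _ _ => trivial, fun _ _ _ _ _ _ => trivial,
      fun _ _ _ _ _ _ => trivial⟩
  | succ m ih =>
    exact ⟨fun _ _ _ => ih.mul_succ hK, fun _ _ => ih.inv_succ hK,
      fun _ _ _ _ => ih.comm_const_succ hK, fun _ _ _ _ => ih.comm_succ hK⟩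

/-! ### Polynomial mappings and levels -/

section Bounded

variable {K : ℕ → Subgroup G} {N : ℕ}

theorem eventuallyEq_one_of_hasLevel (hK : IsCommFiltration K) (hN : K N = ⊥) {m k : ℕ}
    (hk : N ≤ k) {Q : FinSets → G} (h : HasLevel K (m + 1) k Q) : Q =ᶠ[eventually] 1 := by
  filter_upwards [h.1] with α hα
  have := hK.anti hk hα
  rwa [hN, Subgroup.mem_bot] at this

/-- The last derivative that is constrained already lies in a trivial term of the filtration, so one
further derivative costs nothing. For `m = 0` there would be no constraint to start from. -/
theorem HasLevel.succ (hK : IsCommFiltration K) (hN : K N = ⊥) {m k : ℕ} (hm : N < m + k)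
    (hm0 : 0 < m) {Q : FinSets → G} (h : HasLevel K m k Q) : HasLevel K (m + 1) k Q := by
  induction m generalizing k Q with
  | zero => omega
  | succ m ih =>
    by_cases hk : N ≤ k
    · exact (hasLevel_one K _ _).congr (eventuallyEq_one_of_hasLevel hK hN hk h).symm
    · exact ⟨h.1, h.2.mono fun β hβ => ih (by omega) (by omega) hβ⟩

theorem HasLevel.isPolyOfDegree (hK : IsCommFiltration K) (hN : K N = ⊥) {m k : ℕ}
    (hm : N < m + k) (hm0 : 0 < m) {Q : FinSets → G} (h : HasLevel K m k Q) :
    IsPolyOfDegree (N - k + 1) Q := by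
  induction m generalizing k Q with
  | zero => omega
  | succ m ih =>
    by_cases hk : N ≤ k
    · rw [Nat.sub_eq_zero_of_le hk]
      exact ⟨1, fun _ _ _ => (mul_one _).symm, eventuallyEq_one_of_hasLevel hK hN hk h⟩
    · obtain ⟨d, hd⟩ : ∃ d, N - k = d + 1 := ⟨N - k - 1, by omega⟩
      rw [hd]
      refine Filter.mem_of_superset h.2 fun β hβ => ?_
      have := ih (by omega) (by omega) hβ
      rwa [show N - (k + 1) = d by omega] at this

/-- The group of the mappings of level `k` with respect to a filtration of length `N`. -/
def levelSubgroup (hK : IsCommFiltration K) (N k : ℕ) : Subgroup (FinSets → G) where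
  carrier := {Q | HasLevel K (N + 1) k Q}
  mul_mem' := (hK.levelClosed _).mul _ _ _
  one_mem' := hasLevel_one _ _ _
  inv_mem' := (hK.levelClosed _).inv _ _

end Bounded

/-- For `β < α` the derivative of an IP mapping is the commutator of `x` with the constant `(x
β)⁻¹`. -/
theorem isIPMap_hasLevel {K : ℕ → Subgroup G} (hK : IsCommFiltration K) {k : ℕ} (hk : K k = ⊤)
    {x : FinSets → G} (hx : IsIPMap x) (m : ℕ) : HasLevel K m k x := by
  induction m with
  | zero => trivial
  | succ m ih =>
    refine ⟨.of_forall fun α => hk ▸ Subgroup.mem_top _, .of_forall fun β => ?_⟩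
    have h := (hK.levelClosed m).comm_const k k x (x β)⁻¹ ih (hk ▸ Subgroup.mem_top _)
    refine (h.anti hK.anti (show k + 1 ≤ k + k + 1 by omega)).congr ?_
    filter_upwards [eventually_before β] with α hα
    simp only [comm, deriv, Pi.mul_apply, Pi.inv_apply, Function.const_apply,
      FinSets.union_comm α β, hx β α hα]
    group

/-- Each derivative trades one degree for one level, so the filtration must still be full at index
`k + d`, where an IP mapping remains. -/
theorem IsPolyOfDegree.hasLevel {K : ℕ → Subgroup G} (hK : IsCommFiltration K) {d k : ℕ}
    (hk : K (k + d) = ⊤) {P : FinSets → G} (hP : IsPolyOfDegree (d + 1) P) (m : ℕ) :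
    HasLevel K m k P := by
  induction d generalizing k P m with
  | zero =>
    obtain ⟨x, hx, h⟩ := hP
    exact (isIPMap_hasLevel hK hk hx m).congr (Filter.EventuallyEq.symm h)
  | succ d ih =>
    cases m with
    | zero => trivial
    | succ m =>
      have htop : K k = ⊤ := top_le_iff.1 (hk ▸ hK.anti (Nat.le_add_right _ _))
      refine ⟨.of_forall fun α => htop ▸ Subgroup.mem_top _, ?_⟩
      filter_upwards [show {β | IsPolyOfDegree (d + 1) (deriv β P)} ∈ eventually from hP]
        with β hβ using ih (by rwa [show k + 1 + d = k + (d + 1) by omega]) hβ m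

/-! ### Filtrations of nilpotent groups -/

/-- Induction on `b` by the three subgroups lemma, applied in the quotient by the target term, where
containment becomes triviality. -/
theorem commutator_lowerCentralSeries_le (a b : ℕ) :
    ⁅(⊤ : Subgroup G).lowerCentralSeries a, (⊤ : Subgroup G).lowerCentralSeries b⁆ ≤
      (⊤ : Subgroup G).lowerCentralSeries (a + b + 1) := by
  induction b generalizing a with
  | zero => exact le_rfl
  | succ b ih =>
    set L := (⊤ : Subgroup G).lowerCentralSeries with hL
    have h1 : ⁅⁅(⊤ : Subgroup G), L a⁆, L b⁆ ≤ L (a + (b + 1) + 1) := by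
      rw [Subgroup.commutator_comm ⊤]
      exact (ih (a + 1)).trans_eq (by congr 1; omega)
    have h2 : ⁅⁅L a, L b⁆, (⊤ : Subgroup G)⁆ ≤ L (a + (b + 1) + 1) :=
      (Subgroup.commutator_mono (ih a) le_rfl).trans_eq (by rfl)
    set M := L (a + (b + 1) + 1) with hM
    have hn : M.Normal := inferInstance
    have key : ∀ A B C : Subgroup G, ⁅⁅A, B⁆, C⁆ ≤ M →
        ⁅⁅A.map (QuotientGroup.mk' M), B.map (QuotientGroup.mk' M)⁆,
          C.map (QuotientGroup.mk' M)⁆ = ⊥ := fun A B C h => by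
      rw [← Subgroup.map_commutator, ← Subgroup.map_commutator, Subgroup.map_eq_bot_iff,
        QuotientGroup.ker_mk']
      exact h
    have := Subgroup.commutator_commutator_eq_bot_of_rotate (key _ _ _ h1) (key _ _ _ h2)
    rw [← Subgroup.map_commutator, ← Subgroup.map_commutator, Subgroup.map_eq_bot_iff,
        QuotientGroup.ker_mk', Subgroup.commutator_comm] at this
    exact this

/-- Repeating each term `M` times keeps the filtration full below index `M`, which makes room for
mappings of degree greater than one. -/
theorem isCommFiltration_lowerCentralSeries {M : ℕ} (hM : 0 < M) :
    IsCommFiltration fun i => (⊤ : Subgroup G).lowerCentralSeries (i / M) where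
  zero := by simp
  anti := fun i j h => Subgroup.lowerCentralSeries_antitone _ (Nat.div_le_div_right h)
  comm_mem := fun i j x hx y hy => by
    have hle : (i + j + 1) / M ≤ i / M + j / M + 1 := by
      have h1 := Nat.div_add_mod i M
      have h2 := Nat.div_add_mod j M
      have h3 := Nat.mod_lt i hM
      have h4 := Nat.mod_lt j hM
      refine Nat.le_of_lt_succ ((Nat.div_lt_iff_lt_mul hM).2 ?_)
      nlinarith
    refine Subgroup.lowerCentralSeries_antitone _ hle
      (commutator_lowerCentralSeries_le _ _ ?_)
    have := Subgroup.commutator_mem_commutator (inv_mem hx) (inv_mem hy)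
    simpa [commutatorElement_def, comm] using this

/-- A decreasing sequence of groups of mappings, ending with the mappings that are eventually
trivial, in which derivatives and commutators lead from each term into the next one. -/
structure IsPolyFiltration (L : ℕ → Subgroup (FinSets → G)) (N : ℕ) : Prop where
  anti : Antitone L
  mem_last : ∀ Q, Q ∈ L N ↔ Q =ᶠ[eventually] 1
  comm_const_mem : ∀ k, ∀ Q ∈ L k, ∀ g : G, comm Q (Function.const _ g) ∈ L (k + 1)
  comm_mem : ∀ k, ∀ Q ∈ L k, ∀ R ∈ L 1, comm Q R ∈ L (k + 1)
  deriv_mem : ∀ k, ∀ Q ∈ L k, ∀ᶠ β in eventually, deriv β Q ∈ L (k + 1)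

theorem isPolyFiltration_levelSubgroup {K : ℕ → Subgroup G} (hK : IsCommFiltration K) {N : ℕ}
    (hN : K N = ⊥) : IsPolyFiltration (levelSubgroup hK N) N where
  anti := fun _ _ h _ hQ => HasLevel.anti hK.anti h hQ
  mem_last := fun _ => ⟨fun h => eventuallyEq_one_of_hasLevel hK hN le_rfl h,
    fun h => (hasLevel_one K _ _).congr h.symm⟩
  comm_const_mem := fun k Q hQ g => (hK.levelClosed _).comm_const k 0 Q g hQ (by simp [hK.zero])
  comm_mem := fun k Q hQ R hR => (hK.levelClosed _).comm k 1 Q R hQ hR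
  deriv_mem := fun k Q hQ => by
    filter_upwards [hQ.2] with β hβ
    rcases Nat.eq_zero_or_pos N with rfl | hpos
    · refine (hasLevel_one K _ _).congr (Filter.EventuallyEq.symm ?_)
      have h0 : (⊤ : Subgroup G) = ⊥ := by rw [← hK.zero, hN]
      exact .of_forall fun α => Subgroup.mem_bot.1 (h0 ▸ Subgroup.mem_top _)
    · exact HasLevel.succ hK hN (by omega) hpos hβ

theorem exists_isPolyFiltration [Group.IsNilpotent G] {S : Set (FinSets → G)} (hS : S.Finite)
    (hP : ∀ P ∈ S, IsPoly P) : ∃ (L : ℕ → Subgroup (FinSets → G)) (N : ℕ),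
      IsPolyFiltration L N ∧ S ⊆ L 1 ∧ ∀ Q ∈ L 1, IsPoly Q := by
  obtain ⟨n, hn⟩ := Subgroup.nilpotent_iff_lowerCentralSeries.1 ‹Group.IsNilpotent G›
  have hd : ∀ P : FinSets → G, ∃ d, P ∈ S → IsPolyOfDegree (d + 1) P := fun P => by
    by_cases h : P ∈ S
    · obtain ⟨d, hd, h'⟩ := hP P h
      exact ⟨d - 1, fun _ => by rwa [Nat.sub_add_cancel hd]⟩
    · exact ⟨0, fun h' => (h h').elim⟩
  choose d hd using hd
  obtain ⟨D, hD⟩ := (hS.image d).bddAbove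
  -- Degrees in `S` are at most `D + 1`; level `1` requires the filtration to be full up to index `1
  -- + D`.
  have hM : 0 < D + 2 := by omega
  have hK := isCommFiltration_lowerCentralSeries (G := G) hM
  have hN : (⊤ : Subgroup G).lowerCentralSeries ((D + 2) * n / (D + 2)) = ⊥ := by
    rwa [Nat.mul_div_cancel_left n hM]
  refine ⟨_, _, isPolyFiltration_levelSubgroup hK hN, fun P h => ?_, fun Q hQ => ?_⟩
  · refine IsPolyOfDegree.hasLevel hK (d := d P) ?_ (hd P h) _
    have : d P ≤ D := hD ⟨P, h, rfl⟩
    simp [Nat.div_eq_of_lt (show 1 + d P < D + 2 by omega)]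
  · exact ⟨_, by omega, HasLevel.isPolyOfDegree hK hN (m := _ + 1) (by omega) (by omega) hQ⟩

/-! ### Ultrafilters in the smallest ideal -/

section Ultrafilter

attribute [local instance] Ultrafilter.mul Ultrafilter.semigroup

theorem filterClosure_nonempty {X : Type*} (F : Filter X) [F.NeBot] : (filterClosure F).Nonempty :=
  ⟨Ultrafilter.of F, fun _ hA => Ultrafilter.of_le F hA⟩

theorem isClosed_filterClosure {X : Type*} (F : Filter X) : IsClosed (filterClosure F) := by
  have : filterClosure F = ⋂ A ∈ F, {p : Ultrafilter X | A ∈ p} := by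
    ext p; simp [filterClosure]
  rw [this]
  exact isClosed_biInter fun A _ => ultrafilter_isClosed_basic A

theorem mul_mem_filterClosure {F : Filter G} (hF : IsIdempotentFilter F) {p q : Ultrafilter G}
    (hp : p ∈ filterClosure F) (hq : q ∈ filterClosure F) : p * q ∈ filterClosure F := by
  intro A hA
  rw [mem_ultrafilter_mul]
  exact Filter.mem_of_superset (hp _ (hF A hA)) fun x hx => hq _ hx

/-- The elements of `T` that can be recovered from each of their left multiples. -/
def minimalElements (T : Set (Ultrafilter G)) : Set (Ultrafilter G) :=
  {q | q ∈ T ∧ ∀ r ∈ T, ∃ s ∈ T, s * (r * q) = q}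

/-- Any element `q` of a minimal closed left ideal `L` works: right multiplication is continuous, so
`T * (r * q)` is a closed left ideal inside `L` and hence contains `q`. -/
theorem minimalElements_nonempty {T : Set (Ultrafilter G)} (hT : IsClosed T) (hne : T.Nonempty)
    (hmul : ∀ p ∈ T, ∀ q ∈ T, p * q ∈ T) : (minimalElements T).Nonempty := by
  let S : Set (Set (Ultrafilter G)) :=
    {L | IsClosed L ∧ L.Nonempty ∧ L ⊆ T ∧ ∀ t ∈ T, ∀ q ∈ L, t * q ∈ L}
  obtain ⟨L, hL⟩ : ∃ L, Minimal (· ∈ S) L := by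
    refine zorn_superset S fun c hcS hc => ?_
    rcases c.eq_empty_or_nonempty with rfl | hcne
    · exact ⟨T, ⟨hT, hne, subset_rfl, hmul⟩, by simp⟩
    · refine ⟨⋂₀ c, ⟨isClosed_sInter fun s hs => (hcS hs).1, ?_, ?_, ?_⟩,
        fun s hs => Set.sInter_subset_of_mem hs⟩
      · have := hcne.coe_sort
        rw [Set.sInter_eq_iInter]
        refine IsCompact.nonempty_iInter_of_directed_nonempty_isCompact_isClosed _
          (fun a b => (hc.total a.2 b.2).elim (fun h => ⟨a, subset_rfl, h⟩)
            fun h => ⟨b, h, subset_rfl⟩) ?_ ?_ ?_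
        exacts [fun i => (hcS i.2).2.1, fun i => (hcS i.2).1.isCompact, fun i => (hcS i.2).1]
      · obtain ⟨s, hs⟩ := hcne
        exact (Set.sInter_subset_of_mem hs).trans (hcS hs).2.2.1
      · exact fun t ht q hq s hs => (hcS hs).2.2.2 t ht q (hq s hs)
  obtain ⟨⟨hLc, ⟨q, hq⟩, hLT, hLmul⟩, hmin⟩ := hL
  refine ⟨q, hLT hq, fun r hr => ?_⟩
  have hrq : r * q ∈ L := hLmul r hr q hq
  have : L ⊆ (fun s => s * (r * q)) '' T := by
    refine hmin ⟨?_, hne.image _, ?_, ?_⟩ ?_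
    · exact (hT.isCompact.image (Ultrafilter.continuous_mul_left (r * q))).isClosed
    · rintro _ ⟨s, hs, rfl⟩
      exact hmul _ hs _ (hLT hrq)
    · rintro t ht _ ⟨s, hs, rfl⟩
      exact ⟨t * s, hmul t ht s hs, mul_assoc _ _ _⟩
    · rintro _ ⟨s, hs, rfl⟩
      exact hLmul s hs _ hrq
  obtain ⟨s, hs, h⟩ := this hq
  exact ⟨s, hs, h⟩

theorem mul_mem_minimalElements {T : Set (Ultrafilter G)} (hmul : ∀ p ∈ T, ∀ q ∈ T, p * q ∈ T)
    {t q : Ultrafilter G} (ht : t ∈ T) (hq : q ∈ minimalElements T) :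
    t * q ∈ minimalElements T ∧ q * t ∈ minimalElements T := by
  refine ⟨⟨hmul t ht q hq.1, fun r hr => ?_⟩, ⟨hmul q hq.1 t ht, fun r hr => ?_⟩⟩
  · obtain ⟨s, hs, h⟩ := hq.2 (r * t) (hmul r hr t ht)
    exact ⟨t * s, hmul t ht s hs, by rw [mul_assoc, ← mul_assoc r, h]⟩
  · obtain ⟨s, hs, h⟩ := hq.2 r hr
    exact ⟨s, hs, by rw [← mul_assoc r, ← mul_assoc, h]⟩

/-- The elements `w` for which `w⁻¹ A` belongs to the ultrafilter `p`. -/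
def returnSet (p : Ultrafilter G) (A : Set G) : Set G := {w | {y | w * y ∈ A} ∈ p}

/-- For each `r` in the closure write `p = s * (r * p)`. As `A ∈ p` and `V ∈ s`, some `k ∈ V` has
`k⁻¹ (returnSet p A) ∈ r`; compactness leaves finitely many `k`. -/
theorem exists_finite_cover_returnSet {F : Filter G} {p : Ultrafilter G}
    (hp : p ∈ minimalElements (filterClosure F)) {A : Set G} (hA : A ∈ p) {V : Set G} (hV : V ∈ F) :
    ∃ K : Set G, K.Finite ∧ K ⊆ V ∧ {x | ∃ k ∈ K, k * x ∈ returnSet p A} ∈ F := by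
  have hcov : filterClosure F ⊆ ⋃ k ∈ V, {r : Ultrafilter G | {x | k * x ∈ returnSet p A} ∈ r} := by
    intro r hr
    obtain ⟨s, hs, h⟩ := hp.2 r hr
    rw [← h, mem_ultrafilter_mul] at hA
    obtain ⟨k, hk, hkV⟩ := s.nonempty_of_mem (Filter.inter_mem hA (hs V hV))
    refine Set.mem_biUnion hkV ?_
    have hk' : {y | k * y ∈ A} ∈ r * p := hk
    rw [mem_ultrafilter_mul] at hk'
    simpa only [Set.mem_ofPred_eq, returnSet, mul_assoc] using hk'
  obtain ⟨K, hKV, hKfin, hK⟩ := (isClosed_filterClosure F).isCompact.elim_finite_subcover_image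
    (fun k _ => ultrafilter_isOpen_basic _) hcov
  refine ⟨K, hKfin, hKV, Filter.mem_iff_ultrafilter.2 fun r hr => ?_⟩
  obtain ⟨k, hk, hkr⟩ := Set.mem_iUnion₂.1 (hK (show r ∈ filterClosure F from fun B hB => hr hB))
  exact Filter.mem_of_superset hkr fun x hx => ⟨k, hk, hx⟩

theorem smallestIdeal_subset_minimalElements {F : Filter G} [F.NeBot] (hF : IsIdempotentFilter F) :
    smallestIdeal (filterClosure F) ⊆ minimalElements (filterClosure F) := by
  have hmul : ∀ p ∈ filterClosure F, ∀ q ∈ filterClosure F, p * q ∈ filterClosure F :=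
    fun p hp q hq => mul_mem_filterClosure hF hp hq
  exact fun p hp => hp.2 _ ⟨minimalElements_nonempty (isClosed_filterClosure F)
    (filterClosure_nonempty F) hmul, fun _ h => h.1, fun t ht q hq =>
      mul_mem_minimalElements hmul ht hq⟩

/-- For minimal `q`, syndeticity makes `returnSet q A` meet every member of `F`. An ultrafilter `r`
containing it and extending `F` gives `A ∈ r * q`, again minimal. -/
theorem IsFilterSyndetic.exists_minimalElement {F : Filter G} [F.NeBot] (hF : IsIdempotentFilter F)
    {A : Set G} (hA : IsFilterSyndetic F A) : ∃ p ∈ minimalElements (filterClosure F), A ∈ p := by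
  have hmul : ∀ p ∈ filterClosure F, ∀ q ∈ filterClosure F, p * q ∈ filterClosure F :=
    fun p hp q hq => mul_mem_filterClosure hF hp hq
  obtain ⟨q, hq⟩ := minimalElements_nonempty (isClosed_filterClosure F)
    (filterClosure_nonempty F) hmul
  have hmeet : ∀ V ∈ F, (V ∩ returnSet q A).Nonempty := fun V hV => by
    obtain ⟨K, -, hKV, hK⟩ := hA V hV
    have : (⋃ k ∈ (K : Set G), {y | k * y ∈ A}) ∈ q := by
      refine Filter.mem_of_superset (hq.1 _ hK) ?_
      rintro _ ⟨k, hk, a, ha, rfl⟩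
      exact Set.mem_biUnion (Set.mem_inv.1 hk) (by simpa using ha)
    obtain ⟨k, hk, hkq⟩ := (Ultrafilter.finite_biUnion_mem_iff K.finite_toSet).1 this
    exact ⟨k, hKV hk, hkq⟩
  have : (F ⊓ Filter.principal (returnSet q A)).NeBot := Filter.inf_principal_neBot_iff.2 hmeet
  obtain ⟨r, hr⟩ := Ultrafilter.exists_le (F ⊓ Filter.principal (returnSet q A))
  refine ⟨r * q, (mul_mem_minimalElements hmul
    (fun B hB => hr (Filter.mem_inf_of_left hB)) hq).1, ?_⟩
  rw [mem_ultrafilter_mul]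
  exact hr (Filter.mem_inf_of_right (Filter.mem_principal_self _))

end Ultrafilter

/-! ### Weights of finite systems of mappings -/

theorem toLex_lt_toLex_of_le_of_lt {N : ℕ} {f g : Fin N → ℕ} (i : Fin N)
    (hle : ∀ j < i, f j ≤ g j) (hlt : f i < g i) : toLex f < toLex g := by
  refine lt_of_le_of_lt (b := toLex fun j => if j < i then g j else f j) ?_ ?_
  · refine Pi.toLex_monotone fun j => ?_
    split_ifs with h
    exacts [hle j h, le_rfl]
  · exact ⟨i, fun j hj => if_pos hj, by simpa using hlt⟩

/-- The classes modulo `L (k + 1)` of the elements of `S` that lie in `L k` but not in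
`L (k + 1)`. -/
def classes (L : ℕ → Subgroup (FinSets → G)) (S : Set (FinSets → G)) (k : ℕ) :
    Set ((FinSets → G) ⧸ L (k + 1)) :=
  QuotientGroup.mk '' {Q | Q ∈ S ∧ Q ∈ L k ∧ Q ∉ L (k + 1)}

/-- The weight of a system: the numbers of its classes, in lexicographic order. -/
noncomputable def weight (L : ℕ → Subgroup (FinSets → G)) (N : ℕ) (S : Set (FinSets → G)) :
    Lex (Fin N → ℕ) := toLex fun k => (classes L S k).ncard

theorem finite_classes (L : ℕ → Subgroup (FinSets → G)) {S : Set (FinSets → G)} (hS : S.Finite)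
    (k : ℕ) : (classes L S k).Finite := (hS.subset fun _ h => h.1).image _

section

variable {L : ℕ → Subgroup (FinSets → G)} {N : ℕ}

theorem exists_level {Q : FinSets → G} (h1 : Q ∈ L 1) {n : ℕ} (hn : 1 ≤ n) (hQ : Q ∉ L n) :
    ∃ k < n, Q ∈ L k ∧ Q ∉ L (k + 1) := by
  induction n, hn using Nat.le_induction with
  | base => exact (hQ h1).elim
  | succ n _ ih =>
    by_cases h : Q ∈ L n
    · exact ⟨n, n.lt_succ_self, h, hQ⟩
    · obtain ⟨k, hk, h'⟩ := ih h
      exact ⟨k, hk.trans n.lt_succ_self, h'⟩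

theorem level_unique (hL : Antitone L) {Q : FinSets → G} {i j : ℕ} (hi : Q ∈ L i)
    (hi' : Q ∉ L (i + 1)) (hj : Q ∈ L j) (hj' : Q ∉ L (j + 1)) : i = j := by
  by_contra h
  rcases lt_or_gt_of_ne h with h | h
  exacts [hi' (hL h hj), hj' (hL h hi)]

theorem level_of_inv_mul_mem (hL : Antitone L) {Q Q' : FinSets → G} {k : ℕ} (hQ : Q ∈ L k)
    (hQ' : Q ∉ L (k + 1)) (h : Q⁻¹ * Q' ∈ L (k + 1)) : Q' ∈ L k ∧ Q' ∉ L (k + 1) := by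
  refine ⟨?_, fun h' => hQ' ?_⟩
  · exact (Subgroup.mul_mem_cancel_left _ (inv_mem hQ)).1 (hL k.le_succ h)
  · exact inv_mem_iff.1 ((Subgroup.mul_mem_cancel_right _ h').1 h)

theorem one_le_of_notMem {Q : FinSets → G} (hL : Antitone L) (h1 : Q ∈ L 1) (h : Q ∉ L N) :
    1 ≤ N := by
  by_contra h'
  exact h (hL (by omega) h1)

theorem IsPolyFiltration.conj_mem (hL : IsPolyFiltration L N) {k : ℕ} {Q R : FinSets → G}
    (hQ : Q ∈ L k) (hR : R ∈ L 1) : R * Q * R⁻¹ ∈ L k := by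
  have : R * Q * R⁻¹ = Q * comm Q R⁻¹ := by simp only [comm]; group
  rw [this]
  exact mul_mem hQ (hL.anti k.le_succ (hL.comm_mem k Q hQ _ (inv_mem hR)))

theorem weight_le (hL : IsPolyFiltration L N) {S S' : Set (FinSets → G)} (hS : S.Finite)
    (hS1 : S ⊆ L 1) (h : ∀ Q' ∈ S', ∃ Q ∈ S, ∀ k, Q ∈ L k → Q⁻¹ * Q' ∈ L (k + 1)) :
    weight L N S' ≤ weight L N S := by
  refine Pi.toLex_monotone fun i => Set.ncard_le_ncard ?_ (finite_classes L hS i)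
  rintro _ ⟨Q', ⟨hQ'S, hQ', hQ''⟩, rfl⟩
  obtain ⟨Q, hQS, hQ⟩ := h Q' hQ'S
  have hN : Q ∉ L N := fun hN => hQ'' <| hL.anti (show (i : ℕ) + 1 ≤ N by omega)
    ((Subgroup.mul_mem_cancel_left _ (inv_mem hN)).1 (hL.anti N.le_succ (hQ N hN)))
  obtain ⟨k, hk, h1, h2⟩ := exists_level (hS1 hQS) (one_le_of_notMem hL.anti (hS1 hQS) hN) hN
  obtain ⟨h3, h4⟩ := level_of_inv_mul_mem hL.anti h1 h2 (hQ k h1)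
  obtain rfl : k = i := level_unique hL.anti h3 h4 hQ' hQ''
  exact ⟨Q, ⟨hQS, h1, h2⟩, QuotientGroup.eq.2 (hQ _ h1)⟩

/-- Below level `l`, division by `Q₁` is invisible. At level `l` it sends the class of `Q₁` to the
trivial one and maps the other classes onto all that remain; higher levels may grow freely. -/
theorem weight_lt (hL : IsPolyFiltration L N) {S S' : Set (FinSets → G)} (hS : S.Finite)
    (hS1 : S ⊆ L 1) {Q₁ : FinSets → G} (hQ₁S : Q₁ ∈ S) {l : ℕ} (hl : l < N) (hQ₁ : Q₁ ∈ L l)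
    (hmax : ∀ Q ∈ S, Q ∉ L (l + 1))
    (h : ∀ Q' ∈ S', ∃ Q ∈ S, ∀ k ≤ N, Q ∈ L k → Q₁ ∈ L k → (Q * Q₁⁻¹)⁻¹ * Q' ∈ L (k + 1)) :
    weight L N S' < weight L N S := by
  have hlow {Q Q' : FinSets → G} {k : ℕ} (hkl : k < l) (hQ : Q ∈ L k) (hQ0 : Q ∉ L (k + 1))
      (hQQ' : ∀ k ≤ N, Q ∈ L k → Q₁ ∈ L k → (Q * Q₁⁻¹)⁻¹ * Q' ∈ L (k + 1)) :
      Q⁻¹ * Q' ∈ L (k + 1) ∧ Q' ∈ L k ∧ Q' ∉ L (k + 1) := by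
    have h1 := hQQ' k (hkl.trans hl).le hQ (hL.anti hkl.le hQ₁)
    have h2 : Q⁻¹ * Q' ∈ L (k + 1) := by
      have h3 := mul_mem (inv_mem (hL.anti hkl hQ₁)) h1
      convert h3 using 1
      group
    exact ⟨h2, level_of_inv_mul_mem hL.anti hQ hQ0 h2⟩
  refine toLex_lt_toLex_of_le_of_lt ⟨l, hl⟩ (fun i hi => ?_) ?_
  · refine Set.ncard_le_ncard ?_ (finite_classes L hS i)
    rintro _ ⟨Q', ⟨hQ'S, hQ', hQ''⟩, rfl⟩
    obtain ⟨Q, hQS, hQ⟩ := h Q' hQ'S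
    obtain ⟨k, hk, h1, h2⟩ := exists_level (hS1 hQS) (by omega) (hmax Q hQS)
    rcases Nat.lt_succ_iff_lt_or_eq.1 hk with hk | rfl
    · obtain ⟨h3, h4, h5⟩ := hlow hk h1 h2 hQ
      obtain rfl : k = i := level_unique hL.anti h4 h5 hQ' hQ''
      exact ⟨Q, ⟨hQS, h1, h2⟩, QuotientGroup.eq.2 h3⟩
    · refine (hQ'' ?_).elim
      have h3 := (Subgroup.mul_mem_cancel_left _ (inv_mem (mul_mem h1 (inv_mem hQ₁)))).1
        (hL.anti k.le_succ (hQ k hl.le h1 hQ₁))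
      exact hL.anti (show (i : ℕ) + 1 ≤ k from hi) h3
  · have hfin := finite_classes L hS l
    have hmem : (QuotientGroup.mk Q₁ : (FinSets → G) ⧸ L (l + 1)) ∈ classes L S l :=
      ⟨Q₁, ⟨hQ₁S, hQ₁, hmax _ hQ₁S⟩, rfl⟩
    -- The representative is immaterial, because conjugation by `Q₁ ∈ L 1` preserves `L (l + 1)`.
    let f : (FinSets → G) ⧸ L (l + 1) → (FinSets → G) ⧸ L (l + 1) :=
      fun c => QuotientGroup.mk (c.out * Q₁⁻¹)
    have hsub : classes L S' l ⊆ f '' (classes L S l \ {QuotientGroup.mk Q₁}) := by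
      rintro _ ⟨Q', ⟨hQ'S, hQ', hQ''⟩, rfl⟩
      obtain ⟨Q, hQS, hQ⟩ := h Q' hQ'S
      obtain ⟨k, hk, h1, h2⟩ := exists_level (hS1 hQS) (by omega) (hmax Q hQS)
      rcases Nat.lt_succ_iff_lt_or_eq.1 hk with hk | rfl
      · obtain ⟨-, h4, h5⟩ := hlow hk h1 h2 hQ
        exact (hk.ne (level_unique hL.anti h4 h5 hQ' hQ'')).elim
      · have hE := hQ k hl.le h1 hQ₁
        refine ⟨QuotientGroup.mk Q, ⟨⟨Q, ⟨hQS, h1, h2⟩, rfl⟩, fun heq => hQ'' ?_⟩, ?_⟩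
        · have h3 := hL.conj_mem (QuotientGroup.eq.1 (Set.mem_singleton_iff.1 heq).symm)
            (hS1 hQ₁S)
          have h4 := mul_mem h3 hE
          convert h4 using 1
          group
        · obtain ⟨z, hz⟩ := QuotientGroup.mk_out_eq_mul (L (k + 1)) Q
          refine QuotientGroup.eq.2 ?_
          have h3 := mul_mem (hL.conj_mem (inv_mem z.2) (hS1 hQ₁S)) hE
          rw [hz]
          convert h3 using 1
          group
    calc (classes L S' l).ncard ≤ (f '' (classes L S l \ {QuotientGroup.mk Q₁})).ncard :=
          Set.ncard_le_ncard hsub (hfin.sdiff.image f)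
      _ ≤ (classes L S l \ {QuotientGroup.mk Q₁}).ncard := Set.ncard_image_le hfin.sdiff
      _ < (classes L S l).ncard := Set.ncard_sdiff_singleton_lt_of_mem hmem hfin

end

/-! ### Configurations along good collections -/

/-- The part of `V` from which right translations by most elements lead back into `V`. -/
def openCore (F : Filter G) (V : Set G) : Set G := {v | v ∈ V ∧ {y | v * y ∈ V} ∈ F}

theorem openCore_mem {F : Filter G} (hF : IsIdempotentFilter F) {V : Set G} (hV : V ∈ F) :
    openCore F V ∈ F := Filter.inter_mem hV (hF V hV)

theorem mul_mem_openCore {F : Filter G} (hF : IsIdempotentFilter F) {V : Set G} {v : G}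
    (hv : v ∈ openCore F V) : {y | v * y ∈ openCore F V} ∈ F := by
  refine Filter.mem_of_superset (openCore_mem hF hv.2) fun y hy => ⟨hy.1, ?_⟩
  simpa only [Set.mem_ofPred_eq, mul_assoc] using hy.2

theorem IsGoodCollection.eventually_translate_mem {F : Filter G} {Ps : Set (FinSets → G)}
    (hF : IsIdempotentFilter F) (hPs : IsGoodCollection F Ps) {S : Set (FinSets → G)}
    (hS : S.Finite) (hSPs : S ⊆ Ps) {V : Set G} (hV : V ∈ F) :
    ∀ᶠ α in eventually, ∀ R ∈ S, {h | R α * h ∈ V} ∈ F := by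
  refine (Filter.eventually_all_finite hS).2 fun R hR => ?_
  filter_upwards [hPs.measurable R (hSPs hR) _ (hF V hV)] with α hα
  rcases hα with hα | hα
  · exact hα
  · rw [Set.mem_singleton_iff] at hα
    simpa [hα] using hV

/-- For some `α` and `h`, all `P α * h` with `P ∈ S` return to a given member of `p`, with
control over finitely many other values. -/
def HasReturns (F : Filter G) (Ps : Set (FinSets → G)) (p : Ultrafilter G)
    (S : Set (FinSets → G)) : Prop :=
  ∀ Sp : Set (FinSets → G), Sp.Finite → Sp ⊆ Ps → ∀ A ∈ p, ∀ V ∈ F, ∀ n, ∃ α ∈ tail n, ∃ h : G,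
    (∀ R ∈ Sp, R α * h ∈ V) ∧ ∀ P ∈ S, P α * h ∈ returnSet p A

/-- In every finite colouring some `P α * h` with `P ∈ S` have the same colour, with
control over finitely many other values. -/
def HasMonochromatic (F : Filter G) (Ps : Set (FinSets → G)) (S : Set (FinSets → G)) : Prop :=
  ∀ (ι : Type u) [Finite ι] (χ : G → ι), ∀ Sp : Set (FinSets → G), Sp.Finite → Sp ⊆ Ps →
    ∀ V ∈ F, ∀ n, ∃ α ∈ tail n, ∃ h : G, (∀ R ∈ Sp, R α * h ∈ V) ∧ ∃ c, ∀ P ∈ S, χ (P α * h) = c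

/-- The mapping `R ^ k [k, P₀]`. -/
def twist (P₀ : FinSets → G) (k : G) (R : FinSets → G) : FinSets → G :=
  fun α => conj (R α) k * comm k (P₀ α)

/-- A translate by `k` of a twisted configuration is a configuration of the original mappings at a
new base point, the same for all `R`. -/
theorem mul_twist (P₀ : FinSets → G) (k : G) (R : FinSets → G) (α : FinSets) (h : G) :
    k * (twist P₀ k R α * h) = R α * (k * comm k (P₀ α) * h) := by
  simp only [twist, conj]; group

theorem twist_self (P₀ : FinSets → G) (k : G) : twist P₀ k P₀ = P₀ := by
  ext α; simp only [twist, conj, comm]; group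

theorem hasReturns_of_hasMonochromatic {F : Filter G} [F.NeBot] {Ps : Set (FinSets → G)}
    (hF : IsIdempotentFilter F) (hPs : IsGoodCollection F Ps) {p : Ultrafilter G}
    (hp : p ∈ minimalElements (filterClosure F)) {S : Set (FinSets → G)} (hS : S.Finite)
    (hSPs : S ⊆ Ps) {P₀ : FinSets → G} (hP₀ : P₀ ∈ S)
    (h : ∀ K : Set G, K.Finite → K.Nonempty → Set.image2 (twist P₀) K S ⊆ Ps →
      HasMonochromatic F Ps (Set.image2 (twist P₀) K S)) :
    HasReturns F Ps p S := by
  intro Sp hSp hSpPs A hA V hV n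
  have hV₀ : {k | {y | k * y ∈ V} ∈ F} ∩ {k | ∀ R ∈ S ∪ Sp, twist P₀ k R ∈ Ps} ∈ F := by
    refine Filter.inter_mem (hF V hV) ((Filter.eventually_all_finite (hS.union hSp)).2 ?_)
    exact fun R hR => hPs.conj_comm_mem R (hR.elim (@hSPs R) (@hSpPs R)) P₀ (hSPs hP₀)
  obtain ⟨K, hK, hKV, hcov⟩ := exists_finite_cover_returnSet hp hA hV₀
  have : Finite K := hK
  have hKne : K.Nonempty := (F.nonempty_of_mem hcov).elim fun x ⟨k, hk, _⟩ => ⟨k, hk⟩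
  classical
  let χ : G → Option K := fun x =>
    if hx : ∃ k ∈ K, k * x ∈ returnSet p A then some ⟨hx.choose, hx.choose_spec.1⟩ else none
  have hχ (x : G) (k : K) (hx : χ x = some k) : (k : G) * x ∈ returnSet p A := by
    simp only [χ] at hx
    split_ifs at hx with hx'
    rw [← Option.some.inj hx]
    exact hx'.choose_spec.2
  obtain ⟨α, hα, h, hR, c, hc⟩ := h K hK hKne
    (by rintro _ ⟨k, hk, R, hR, rfl⟩; exact (hKV hk).2 R (Or.inl hR)) (Option K) χ
    -- Since `P₀` is its own twist, controlling it forces the common colour to be some `k ∈ K`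
    -- rather than `none`.
    (insert P₀ (Set.image2 (twist P₀) K Sp)) ((hK.image2 _ hSp).insert _)
    (Set.insert_subset (hSPs hP₀)
      (by rintro _ ⟨k, hk, R, hR, rfl⟩; exact (hKV hk).2 R (Or.inr hR)))
    ({x | ∃ k ∈ K, k * x ∈ returnSet p A} ∩ {y | ∀ k ∈ K, k * y ∈ V})
    (Filter.inter_mem hcov ((Filter.eventually_all_finite hK).2 fun k hk => (hKV hk).1)) n
  obtain ⟨k, rfl⟩ : ∃ k, c = some k := by
    have hx := (hR P₀ (Set.mem_insert _ _)).1
    obtain ⟨k, hk, -⟩ := id hx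
    have := hc _ ⟨k, hk, P₀, hP₀, twist_self P₀ k⟩
    rw [← this]
    exact ⟨_, dif_pos hx⟩
  refine ⟨α, hα, k * comm k.1 (P₀ α) * h, fun R hRSp => ?_, fun P hP => ?_⟩
  · rw [← mul_twist]
    exact (hR _ (Or.inr ⟨k, k.2, R, hRSp, rfl⟩)).2 k k.2
  · rw [← mul_twist]
    exact hχ _ k (hc _ ⟨k, k.2, P, hP, rfl⟩)

/-! ### Colour focusing -/

/-- The extension of a mapping by the value `1` at the empty set. -/
noncomputable def ext (P : FinSets → G) (s : Finset ℕ) : G :=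
  open Classical in if h : s.Nonempty then P ⟨s, h⟩ else 1

theorem ext_empty (P : FinSets → G) : ext P ∅ = 1 := by simp [ext]

theorem ext_coe (P : FinSets → G) (α : FinSets) : ext P α.1 = P α := by simp [ext, α.2]

theorem ext_union_coe (P : FinSets → G) (α β : FinSets) :
    ext P (α.1 ∪ β.1) = P (FinSets.union α β) := ext_coe P (FinSets.union α β)

/-- The point `P s * (P₀ s)⁻¹ * P₀ b * g`. -/
noncomputable def focusPoint (P₀ P : FinSets → G) (s b : Finset ℕ) (g : G) : G :=
  ext P s * (ext P₀ s)⁻¹ * ext P₀ b * g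

/-- The mapping that describes how a focus point moves. -/
noncomputable def focusMap (P₀ P : FinSets → G) (s b : Finset ℕ) (g : G) : FinSets → G :=
  fun α => (focusPoint P₀ P s b g)⁻¹ * focusPoint P₀ P (α.1 ∪ s) (α.1 ∪ b) g

theorem focusPoint_empty (P₀ P : FinSets → G) (b : Finset ℕ) (g : G) :
    focusPoint P₀ P ∅ b g = ext P₀ b * g := by simp [focusPoint, ext_empty]

theorem focusPoint_union (P₀ P : FinSets → G) (s b : Finset ℕ) (g h : G) (α : FinSets) :
    focusPoint P₀ P (α.1 ∪ s) (α.1 ∪ b) (g * h) =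
      focusPoint P₀ P s b g * (focusMap P₀ P s b g α * h) := by
  simp only [focusMap, focusPoint]; group

theorem focusMap_empty_empty (P₀ P : FinSets → G) : focusMap P₀ P ∅ ∅ 1 = P := by
  ext α
  simp [focusMap, focusPoint, ext_empty, ext_coe]

theorem focusMap_empty_coe (P₀ P : FinSets → G) (β : FinSets) (g : G) :
    focusMap P₀ P ∅ β.1 g = fun α => conj (P α * deriv β P₀ α) (ext P₀ β.1 * g) := by
  ext α
  simp only [focusMap, focusPoint, ext_empty, ext_coe, ext_union_coe, Finset.union_empty, conj,
    deriv]
  group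

/-- This has the shape required by axiom IV, with the focus map at the start of the thread as both
`R` and `P`. Hence a thread remembers `β₁` and `g₁` and keeps the conjugator in `C`. -/
theorem focusMap_coe (P₀ P : FinSets → G) (γ : FinSets) (β₁ : Finset ℕ) (g₁ g : G) :
    focusMap P₀ P γ.1 (γ.1 ∪ β₁) g =
      fun α => conj (focusMap P₀ P ∅ β₁ g₁ α * deriv γ (focusMap P₀ P ∅ β₁ g₁) α)
        ((ext P₀ β₁ * g₁)⁻¹ * focusPoint P₀ P γ.1 (γ.1 ∪ β₁) g) := by
  ext α
  have h : (FinSets.union α γ).1 = α.1 ∪ γ.1 := rfl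
  simp only [focusMap, focusPoint, ext_empty, conj, deriv, Finset.union_empty, h,
    Finset.union_assoc]
  group

/-- A stage of the focusing process for one colour class `A`: the points `focusPoint P₀ P γ β g`
with `P ∈ S₁` lie in `A` along `p`, and for `P ∈ Sp` the corresponding `focusMap`s belong to the
collection `Ps`, now and after any further step that is close enough to the identity. -/
structure IsThread (F : Filter G) (Ps : Set (FinSets → G)) (p : Ultrafilter G) (P₀ : FinSets → G)
    (Sp S₁ : Set (FinSets → G)) (U A : Set G) (β₁ : Finset ℕ) (g₁ : G) (C : Set G) (m : ℕ)
    (β γ : Finset ℕ) (g : G) : Prop where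
  union : β = γ ∪ β₁
  le : ∀ x ∈ γ, m ≤ x
  isOpen : ∀ c ∈ C, {h | c * h ∈ C} ∈ F
  good : ∀ P ∈ Sp, ∀ c ∈ C, ∀ δ ∈ tail m,
    (fun α => conj (focusMap P₀ P ∅ β₁ g₁ α * deriv δ (focusMap P₀ P ∅ β₁ g₁) α) c) ∈ Ps
  target : ∀ c ∈ C, ext P₀ β₁ * g₁ * c ∈ U
  near : ∀ P ∈ Sp, {h | (ext P₀ β₁ * g₁)⁻¹ * focusPoint P₀ P γ β g * h ∈ C} ∈ F
  mem : γ.Nonempty → ∀ P ∈ Sp, (ext P₀ β₁ * g₁)⁻¹ * focusPoint P₀ P γ β g ∈ C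
  map_mem : ∀ P ∈ Sp, focusMap P₀ P γ β g ∈ Ps
  val : ∀ P ∈ S₁, focusPoint P₀ P γ β g ∈ returnSet p A

section Focusing

variable {F : Filter G} {Ps : Set (FinSets → G)} {p : Ultrafilter G} {P₀ : FinSets → G}
  {Sp S₁ : Set (FinSets → G)} {U A : Set G} {β₁ : Finset ℕ} {g₁ : G} {C : Set G} {m : ℕ}
  {β γ : Finset ℕ} {g : G}

theorem IsThread.extend (ht : IsThread F Ps p P₀ Sp S₁ U A β₁ g₁ C m β γ g) {α : FinSets} {h : G}
    (hα : α ∈ tail m)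
    (hC : ∀ P ∈ Sp, focusMap P₀ P γ β g α * h ∈
      {h | (ext P₀ β₁ * g₁)⁻¹ * focusPoint P₀ P γ β g * h ∈ C})
    (hA : ∀ P ∈ S₁, focusMap P₀ P γ β g α * h ∈
      returnSet p {y | focusPoint P₀ P γ β g * y ∈ A}) :
    IsThread F Ps p P₀ Sp S₁ U A β₁ g₁ C m (α.1 ∪ β) (α.1 ∪ γ) (g * h) := by
  have hmem : ∀ P ∈ Sp,
      (ext P₀ β₁ * g₁)⁻¹ * focusPoint P₀ P (α.1 ∪ γ) (α.1 ∪ β) (g * h) ∈ C := fun P hP => by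
    have := hC P hP
    rwa [Set.mem_ofPred_eq, mul_assoc, ← focusPoint_union] at this
  have hle : ∀ x ∈ α.1 ∪ γ, m ≤ x := fun x hx => (Finset.mem_union.1 hx).elim (hα x) (ht.le x)
  refine ⟨?_, hle, ht.isOpen, ht.good, ht.target, fun P hP => ht.isOpen _ (hmem P hP),
    fun _ => hmem, fun P hP => ?_, fun P hP => ?_⟩
  · rw [ht.union, Finset.union_assoc]
  · have hγ : (α.1 ∪ γ).Nonempty := α.2.mono Finset.subset_union_left
    have := focusMap_coe P₀ P ⟨_, hγ⟩ β₁ g₁ (g * h)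
    have hβ : α.1 ∪ β = α.1 ∪ γ ∪ β₁ := by rw [ht.union, Finset.union_assoc]
    have h' := hmem P hP
    rw [hβ] at h' ⊢
    rw [this]
    exact ht.good P hP _ h' ⟨_, hγ⟩ hle
  · have := hA P hP
    simp only [returnSet, Set.mem_ofPred_eq, focusPoint_union, mul_assoc] at this ⊢
    exact this

end Focusing

/-! ### Running the focusing process. -/

section Focusing

variable {F : Filter G} {Ps : Set (FinSets → G)} {p : Ultrafilter G} {P₀ : FinSets → G}
  {Sp S₁ : Set (FinSets → G)}

theorem IsGoodCollection.exists_good (hPs : IsGoodCollection F Ps) {S : Set (FinSets → G)}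
    (hS : S.Finite) {Q R : (FinSets → G) → FinSets → G} (hQ : ∀ P ∈ S, Q P ∈ Ps)
    (hR : ∀ P ∈ S, R P ∈ Ps) (n : ℕ) : ∃ C ∈ F, ∃ m, n ≤ m ∧ ∀ P ∈ S, ∀ c ∈ C, ∀ δ ∈ tail m,
      (fun α => conj (Q P α * deriv δ (R P) α) c) ∈ Ps := by
  have h : ∀ P, ∃ C ∈ F, ∃ m, P ∈ S → ∀ c ∈ C, ∀ δ ∈ tail m,
      (fun α => conj (Q P α * deriv δ (R P) α) c) ∈ Ps := fun P => by
    by_cases hP : P ∈ S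
    · obtain ⟨C, hC, T, hT, h⟩ := hPs.conj_deriv_mem _ (hQ P hP) _ (hR P hP)
      obtain ⟨m, hm⟩ := mem_eventually_iff.1 hT
      exact ⟨C, hC, m, fun _ c hc δ hδ => h c hc δ (hm hδ)⟩
    · exact ⟨Set.univ, Filter.univ_mem, 0, fun h => (hP h).elim⟩
  choose C hC m hm using h
  obtain ⟨b, hb⟩ := (hS.image m).bddAbove
  refine ⟨⋂ P ∈ S, C P, (Filter.biInter_mem hS).2 fun P _ => hC P, max n b, le_max_left _ _, ?_⟩
  intro P hP c hc δ hδ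
  exact hm P hP c (Set.mem_iInter₂.1 hc P hP) δ
    (tail_antitone ((hb ⟨P, hP, rfl⟩).trans (le_max_right _ _)) hδ)

/-- A thread starts with `γ = ∅`, where all its focus points coincide with the focus `P₀ β * g`. -/
theorem exists_isThread (hF : IsIdempotentFilter F) (hPs : IsGoodCollection F Ps)
    (hSp : Sp.Finite) {U A : Set G} {β : Finset ℕ} {g : G}
    (hmap : ∀ P ∈ Sp, focusMap P₀ P ∅ β g ∈ Ps) (hU : {h | ext P₀ β * g * h ∈ U} ∈ F)
    (hA : ext P₀ β * g ∈ returnSet p A) (n : ℕ) :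
    ∃ C m, n ≤ m ∧ IsThread F Ps p P₀ Sp S₁ U A β g C m β ∅ g := by
  obtain ⟨C, hC, m, hnm, hm⟩ := hPs.exists_good hSp hmap hmap n
  refine ⟨openCore F (C ∩ {h | ext P₀ β * g * h ∈ U}), m, hnm, ?_⟩
  have hC' := openCore_mem hF (Filter.inter_mem hC hU)
  refine ⟨(Finset.empty_union _).symm, by simp, fun c hc => mul_mem_openCore hF hc,
    fun P hP c hc => hm P hP c hc.1.1, fun c hc => hc.1.2, fun P _ => ?_, by simp, hmap,
    fun P _ => ?_⟩
  · refine Filter.mem_of_superset hC' fun h hh => ?_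
    simpa only [focusPoint_empty, inv_mul_cancel, one_mul, Set.mem_ofPred_eq] using hh
  · rwa [focusPoint_empty]

/-- A stage of the focusing process in which the colours in `J` have been used. -/
def FocusState (F : Filter G) (Ps : Set (FinSets → G)) (p : Ultrafilter G) (P₀ : FinSets → G)
    (Sp S₁ : Set (FinSets → G)) (U C₀ : Set G) (n m₀ : ℕ) {ι : Type u} (χ : G → ι)
    (J : Finset ι) : Prop :=
  ∃ (β : Finset ℕ) (g : G), (∀ x ∈ β, m₀ ≤ x) ∧ (∀ P ∈ Sp, focusMap P₀ P ∅ β g ∈ Ps) ∧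
    {h | ext P₀ β * g * h ∈ C₀} ∈ F ∧ ∀ i ∈ J, ∃ γ C β₁ g₁ m, n ≤ m ∧ γ.Nonempty ∧
      IsThread F Ps p P₀ Sp S₁ U (χ ⁻¹' {i}) β₁ g₁ C m β γ g

/-- If the focus has the colour of the thread, take `α = γ` and `h = (P₀ γ)⁻¹ * P₀ β * g * y`: then
`P₀ α * h` is the focus times `y`, and the other `P α * h` are the focus points times `y`. -/
theorem IsThread.exists_monochromatic (hp : p ∈ filterClosure F) {V : Set G} {n m : ℕ}
    {ι : Type u} {χ : G → ι} {i : ι} {β₁ β γ : Finset ℕ} {g₁ g : G} {C : Set G}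
    (hSp : Sp.Finite) (hS₁ : S₁.Finite)
    (ht : IsThread F Ps p P₀ Sp S₁ {u | {y | u * y ∈ V} ∈ F} (χ ⁻¹' {i}) β₁ g₁ C m β γ g)
    (hnm : n ≤ m) (hγ : γ.Nonempty) (hi : ext P₀ β * g ∈ returnSet p (χ ⁻¹' {i})) :
    ∃ α ∈ tail n, ∃ h : G, (∀ R ∈ Sp, R α * h ∈ V) ∧ ∃ c, ∀ P ∈ insert P₀ S₁, χ (P α * h) = c := by
  have h₁ : ∀ᶠ y in (p : Filter G), ∀ P ∈ S₁, focusPoint P₀ P γ β g * y ∈ χ ⁻¹' {i} :=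
    (Filter.eventually_all_finite hS₁).2 ht.val
  have h₂ : ∀ᶠ y in (p : Filter G), ∀ P ∈ Sp, focusPoint P₀ P γ β g * y ∈ V :=
    (Filter.eventually_all_finite hSp).2 fun P hP => hp _ <| by
      simpa [mul_assoc] using ht.target _ (ht.mem hγ P hP)
  have h₃ : ∀ᶠ y in (p : Filter G), ext P₀ β * g * y ∈ χ ⁻¹' {i} := hi
  obtain ⟨y, hy₁, hy₂, hy₃⟩ := (h₁.and (h₂.and h₃)).exists
  have key (P : FinSets → G) : P ⟨γ, hγ⟩ * ((P₀ ⟨γ, hγ⟩)⁻¹ * ext P₀ β * g * y) =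
      focusPoint P₀ P γ β g * y := by
    have h (P : FinSets → G) : ext P γ = P ⟨γ, hγ⟩ := ext_coe P ⟨γ, hγ⟩
    simp only [focusPoint, h, mul_assoc]
  refine ⟨⟨γ, hγ⟩, fun x hx => hnm.trans (ht.le x hx),
    (P₀ ⟨γ, hγ⟩)⁻¹ * ext P₀ β * g * y, fun R hR => key R ▸ hy₂ R hR, i, ?_⟩
  rintro P (rfl | hP)
  · simpa [mul_assoc] using hy₃
  · exact key P ▸ hy₁ P hP

theorem exists_mem_returnSet_preimage {ι : Type u} [Finite ι] (χ : G → ι) (p : Ultrafilter G)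
    (c : G) : ∃ i, c ∈ returnSet p (χ ⁻¹' {i}) := by
  by_contra! h
  have : ∀ᶠ y in (p : Filter G), ∀ i, ¬ χ (c * y) = i :=
    Filter.eventually_all.2 fun i => Ultrafilter.eventually_not.2 (h i)
  obtain ⟨y, hy⟩ := this.exists
  exact hy _ rfl

theorem returnSet_mono {A B : Set G} (h : A ⊆ B) : returnSet p A ⊆ returnSet p B :=
  fun _ hw => Filter.mem_of_superset hw fun _ hy => h hy

/-- Either the colour of the focus was used before, and its thread gives the configuration, or a new
thread starts at the focus. Returns for all focus maps then extend every thread by one common `α`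
and `h`. -/
theorem FocusState.step (hF : IsIdempotentFilter F) (hPs : IsGoodCollection F Ps)
    (hp : p ∈ filterClosure F) {V C₀ : Set G} {n m₀ : ℕ} {ι : Type u} [Finite ι] [DecidableEq ι]
    {χ : G → ι} (hSp : Sp.Finite) (hS₁ : S₁.Finite) (hP₀Sp : P₀ ∈ Sp) (hS₁Sp : S₁ ⊆ Sp)
    (hC₀ : ∀ c ∈ C₀, {h | c * h ∈ C₀} ∈ F) (hC₀V : C₀ ⊆ {u | {y | u * y ∈ V} ∈ F})
    (hgood : ∀ P ∈ Sp, ∀ c ∈ C₀, ∀ δ ∈ tail m₀, (fun α => conj (P α * deriv δ P₀ α) c) ∈ Ps)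
    (hstep : ∀ (β : Finset ℕ) (g : G) (Γ : Set (Finset ℕ)), Γ.Finite → (∀ γ ∈ Γ, ∀ x ∈ γ, n ≤ x) →
      Set.image2 (fun γ P => focusMap P₀ P γ β g) (insert ∅ Γ) S₁ ⊆ Ps →
      HasReturns F Ps p (Set.image2 (fun γ P => focusMap P₀ P γ β g) (insert ∅ Γ) S₁))
    {J : Finset ι} (hJ : FocusState F Ps p P₀ Sp S₁ {u | {y | u * y ∈ V} ∈ F} C₀ n m₀ χ J) :
    (∃ α ∈ tail n, ∃ h : G, (∀ R ∈ Sp, R α * h ∈ V) ∧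
      ∃ c, ∀ P ∈ insert P₀ S₁, χ (P α * h) = c) ∨
    ∃ i ∉ J, FocusState F Ps p P₀ Sp S₁ {u | {y | u * y ∈ V} ∈ F} C₀ n m₀ χ (insert i J) := by
  obtain ⟨β, g, hβ, hmap, hnear, hJ⟩ := hJ
  obtain ⟨i, hi⟩ := exists_mem_returnSet_preimage χ p (ext P₀ β * g)
  by_cases hiJ : i ∈ J
  · obtain ⟨γ, C, β₁, g₁, m, hnm, hγ, ht⟩ := hJ i hiJ
    exact Or.inl (ht.exists_monochromatic hp hSp hS₁ hnm hγ hi)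
  refine Or.inr ⟨i, hiJ, ?_⟩
  have hthreads : ∀ j ∈ insert i J, ∃ γ C β₁ g₁ m, n ≤ m ∧
      IsThread F Ps p P₀ Sp S₁ {u | {y | u * y ∈ V} ∈ F} (χ ⁻¹' {j}) β₁ g₁ C m β γ g := by
    intro j hj
    rcases Finset.mem_insert.1 hj with rfl | hj
    · obtain ⟨C, m, hnm, ht⟩ := exists_isThread (S₁ := S₁) (U := {u | {y | u * y ∈ V} ∈ F})
        hF hPs hSp hmap
        (Filter.mem_of_superset hnear fun h hh => hC₀V hh) hi n
      exact ⟨∅, C, β, g, m, hnm, ht⟩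
    · obtain ⟨γ, C, β₁, g₁, m, hnm, -, ht⟩ := hJ j hj
      exact ⟨γ, C, β₁, g₁, m, hnm, ht⟩
  choose! γ C β₁ g₁ m hnm ht using hthreads
  set Γ : Set (Finset ℕ) := γ '' (insert i J : Finset ι) with hΓ
  have hΓfin : Γ.Finite := (Finset.finite_toSet _).image _
  have hmapΓ : ∀ s ∈ insert ∅ Γ, ∀ P ∈ Sp, focusMap P₀ P s β g ∈ Ps := by
    rintro s (rfl | ⟨j, hj, rfl⟩) P hP
    · exact hmap P hP
    · exact (ht j hj).map_mem P hP
  -- `W` keeps the conjugators in the sets for which axiom IV applies; `B` below preserves the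
  -- colours.
  set W : Set G := {h | ext P₀ β * g * h ∈ C₀} ∩ ⋂ j ∈ (insert i J : Finset ι), ⋂ P ∈ Sp,
    {h | (ext P₀ (β₁ j) * g₁ j)⁻¹ * focusPoint P₀ P (γ j) β g * h ∈ C j} with hW
  have hWF : W ∈ F := Filter.inter_mem hnear <| (Filter.biInter_mem (Finset.finite_toSet _)).2
    fun j hj => (Filter.biInter_mem hSp).2 fun P hP => (ht j hj).near P hP
  set B : Set G := ⋂ j ∈ (insert i J : Finset ι), ⋂ P ∈ S₁,
    {y | focusPoint P₀ P (γ j) β g * y ∈ χ ⁻¹' {j}} with hB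
  have hBp : B ∈ p := (Filter.biInter_mem (Finset.finite_toSet _)).2
    fun j hj => (Filter.biInter_mem hS₁).2 fun P hP => (ht j hj).val P hP
  obtain ⟨α, hα, h, hR, hret⟩ := hstep β g Γ hΓfin
    (by rintro _ ⟨j, hj, rfl⟩ x hx; exact (hnm j hj).trans ((ht j hj).le x hx))
    (by rintro _ ⟨s, hs, P, hP, rfl⟩; exact hmapΓ s hs P (hS₁Sp hP))
    (Set.image2 (fun γ P => focusMap P₀ P γ β g) (insert ∅ Γ) Sp)
    ((hΓfin.insert _).image2 _ hSp)
    (by rintro _ ⟨s, hs, P, hP, rfl⟩; exact hmapΓ s hs P hP)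
    B hBp W hWF (max m₀ ((insert i J).sup m))
  have hαm₀ : α ∈ tail m₀ := tail_antitone (le_max_left _ _) hα
  have hle : ∀ x ∈ α.1 ∪ β, m₀ ≤ x := fun x hx => (Finset.mem_union.1 hx).elim (hαm₀ x) (hβ x)
  have hC₀' : ext P₀ (α.1 ∪ β) * (g * h) ∈ C₀ := by
    have h1 : ext P₀ β * g * (focusMap P₀ P₀ ∅ β g α * h) ∈ C₀ :=
      (hR _ ⟨∅, Set.mem_insert _ _, P₀, hP₀Sp, rfl⟩).1
    rw [← focusPoint_empty P₀ P₀, ← focusPoint_union] at h1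
    simpa only [focusPoint, mul_inv_cancel, one_mul] using h1
  have hne : (α.1 ∪ β).Nonempty := α.2.mono Finset.subset_union_left
  refine ⟨α.1 ∪ β, g * h, hle, fun P hP => ?_, hC₀ _ hC₀', fun j hj => ?_⟩
  · have := focusMap_empty_coe P₀ P ⟨_, hne⟩ (g * h)
    rw [this]
    exact hgood P hP _ hC₀' ⟨_, hne⟩ hle
  · refine ⟨α.1 ∪ γ j, C j, β₁ j, g₁ j, m j, hnm j hj, α.2.mono Finset.subset_union_left,
      (ht j hj).extend ?_ (fun P hP => ?_) fun P hP => ?_⟩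
    · exact tail_antitone ((Finset.le_sup hj).trans (le_max_right _ _)) hα
    · have := (hR _ ⟨γ j, Or.inr ⟨j, hj, rfl⟩, P, hP, rfl⟩).2
      exact Set.mem_iInter₂.1 (Set.mem_iInter₂.1 this j hj) P hP
    · refine returnSet_mono ?_ (hret _ ⟨γ j, Or.inr ⟨j, hj, rfl⟩, P, hP, rfl⟩)
      exact fun y hy => Set.mem_iInter₂.1 (Set.mem_iInter₂.1 hy j hj) P hP

theorem hasMonochromatic_of_step (hF : IsIdempotentFilter F) (hPs : IsGoodCollection F Ps)
    (hp : p ∈ filterClosure F) (hS₁ : S₁.Finite) (hS₁Ps : S₁ ⊆ Ps) (hP₀ : P₀ ∈ Ps) (n₀ : ℕ)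
    (hstep : ∀ (β : Finset ℕ) (g : G) (Γ : Set (Finset ℕ)), Γ.Finite →
      (∀ γ ∈ Γ, ∀ x ∈ γ, n₀ ≤ x) →
      Set.image2 (fun γ P => focusMap P₀ P γ β g) (insert ∅ Γ) S₁ ⊆ Ps →
      HasReturns F Ps p (Set.image2 (fun γ P => focusMap P₀ P γ β g) (insert ∅ Γ) S₁)) :
    HasMonochromatic F Ps (insert P₀ S₁) := by
  intro ι _ χ Sp₀ hSp₀ hSp₀Ps V hV n₁
  classical
  have := Fintype.ofFinite ι
  set Sp := Sp₀ ∪ insert P₀ S₁ with hSpdef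
  have hSp : Sp.Finite := hSp₀.union (hS₁.insert _)
  have hSpPs : Sp ⊆ Ps := Set.union_subset hSp₀Ps (Set.insert_subset hP₀ hS₁Ps)
  obtain ⟨C, hC, m₀, -, hm₀⟩ := hPs.exists_good hSp (Q := id) (R := fun _ => P₀)
    (fun P hP => hSpPs hP) (fun _ _ => hP₀) 0
  set C₀ := openCore F (C ∩ {u | {y | u * y ∈ V} ∈ F}) with hC₀
  have hC₀F : C₀ ∈ F := openCore_mem hF (Filter.inter_mem hC (hF V hV))
  set n := max n₀ n₁ with hn
  have key (J : Finset ι) :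
      FocusState F Ps p P₀ Sp S₁ {u | {y | u * y ∈ V} ∈ F} C₀ n m₀ χ J →
      ∃ α ∈ tail n, ∃ h : G, (∀ R ∈ Sp, R α * h ∈ V) ∧
        ∃ c, ∀ P ∈ insert P₀ S₁, χ (P α * h) = c := by
    -- Induction on the number of unused colours.
    induction hk : Fintype.card ι - J.card using Nat.strong_induction_on generalizing J with
    | _ k ih =>
      intro hJ
      rcases hJ.step hF hPs hp hSp hS₁ (Or.inr (Or.inl rfl)) (fun P hP => Or.inr (Or.inr hP))
        (fun c hc => mul_mem_openCore hF hc) (fun c hc => hc.1.2)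
        (fun P hP c hc => hm₀ P hP c hc.1.1)
        (fun β g Γ hΓ h => hstep β g Γ hΓ fun γ hγ x hx => (le_max_left _ _).trans (h γ hγ x hx))
        with h | ⟨i, hi, hJ'⟩
      · exact h
      · have h1 := Finset.card_lt_univ_of_notMem hi
        have h2 := Finset.card_insert_of_notMem hi
        exact ih _ (by omega) _ rfl hJ'
  obtain ⟨α, hα, h, hR, hc⟩ := key ∅ ⟨∅, 1, by simp,
    fun P hP => by rw [focusMap_empty_empty]; exact hSpPs hP,
    by simpa [ext_empty] using hC₀F, by simp⟩
  exact ⟨α, tail_antitone (le_max_right _ _) hα, h, fun R hR' => hR R (Or.inl hR'), hc⟩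

end Focusing

/-! ### Induction on the weight -/

section Induction

variable {F : Filter G} {Ps : Set (FinSets → G)} {p : Ultrafilter G}
  {L : ℕ → Subgroup (FinSets → G)} {N : ℕ}

theorem IsPolyFiltration.inv_mul_conj_mem (hL : IsPolyFiltration L N) {k : ℕ} {Q : FinSets → G}
    (hQ : Q ∈ L k) (c : G) : Q⁻¹ * conj Q (Function.const _ c) ∈ L (k + 1) := by
  rw [conj_eq_mul_comm, inv_mul_cancel_left]
  exact hL.comm_const_mem k Q hQ c

theorem focusMap_mul_inv (P₀ P P₁ : FinSets → G) (γ β : Finset ℕ) (g : G) :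
    focusMap P₀ P γ β g * (focusMap P₀ P₁ ∅ β g)⁻¹ =
      conj ((fun α => (ext (P * P₀⁻¹) γ)⁻¹ * ext (P * P₀⁻¹) (α.1 ∪ γ)) * (P₁ * P₀⁻¹)⁻¹)
        (Function.const _ (ext P₀ β * g)) := by
  have hext (s : Finset ℕ) : ext (P * P₀⁻¹) s = ext P s * (ext P₀ s)⁻¹ := by
    simp only [ext]
    split_ifs <;> simp
  ext α
  simp only [focusMap, focusPoint, conj, Pi.mul_apply, Pi.inv_apply, Function.const_apply, hext,
    ext_empty, Finset.union_empty, ext_coe]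
  group

theorem IsPolyFiltration.inv_mul_shift_mem (hL : IsPolyFiltration L N) {k : ℕ} {Q : FinSets → G}
    (hQ : Q ∈ L k) {γ : Finset ℕ} (hγ : ∀ h : γ.Nonempty, deriv ⟨γ, h⟩ Q ∈ L (k + 1)) :
    Q⁻¹ * (fun α => (ext Q γ)⁻¹ * ext Q (α.1 ∪ γ)) ∈ L (k + 1) := by
  rcases γ.eq_empty_or_nonempty with rfl | hne
  · convert one_mem (L (k + 1)) using 1
    ext α
    simp [ext_empty, ext_coe]
  · have h1 : Q * deriv ⟨γ, hne⟩ Q ∈ L k := mul_mem hQ (hL.anti k.le_succ (hγ hne))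
    convert mul_mem (hγ hne) (hL.comm_const_mem k _ h1 (Q ⟨γ, hne⟩)) using 1
    ext α
    have e1 := ext_coe Q ⟨γ, hne⟩
    have e2 := ext_union_coe Q α ⟨γ, hne⟩
    simp only at e1 e2
    simp only [e1, e2, Pi.mul_apply, Pi.inv_apply, comm, deriv, Function.const_apply]
    group

/-- By `focusMap_mul_inv` only a shift along `γ` and a conjugation by a constant separate the two
sides; both are invisible modulo the next level. -/
theorem IsPolyFiltration.focusMap_mem (hL : IsPolyFiltration L N) {k : ℕ} {P₀ P P₁ : FinSets → G}
    (hP : P * P₀⁻¹ ∈ L k) (hP₁ : P₁ * P₀⁻¹ ∈ L k) (hP₁' : P₁ * P₀⁻¹ ∈ L 1) {γ : Finset ℕ}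
    (hγ : ∀ h : γ.Nonempty, deriv ⟨γ, h⟩ (P * P₀⁻¹) ∈ L (k + 1)) (β : Finset ℕ) (g : G) :
    (P * P₀⁻¹ * (P₁ * P₀⁻¹)⁻¹)⁻¹ * (focusMap P₀ P γ β g * (focusMap P₀ P₁ ∅ β g)⁻¹) ∈
      L (k + 1) := by
  rw [focusMap_mul_inv]
  set Q := P * P₀⁻¹
  set Q₁ := P₁ * P₀⁻¹
  have h1 := hL.inv_mul_shift_mem hP hγ
  set Y : FinSets → G := fun α => (ext Q γ)⁻¹ * ext Q (α.1 ∪ γ)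
  have hY : Y ∈ L k := (Subgroup.mul_mem_cancel_left _ (inv_mem hP)).1 (hL.anti k.le_succ h1)
  have h2 := hL.inv_mul_conj_mem (mul_mem hY (inv_mem hP₁)) (ext P₀ β * g)
  convert mul_mem (hL.conj_mem h1 hP₁') h2 using 1
  group

theorem hasReturns_empty [F.NeBot] (hF : IsIdempotentFilter F) (hPs : IsGoodCollection F Ps) :
    HasReturns F Ps p ∅ := by
  intro Sp hSp hSpPs A _ V hV n
  obtain ⟨α, hα, h⟩ :=
    (Filter.Eventually.and (tail_mem_eventually n)
      (hPs.eventually_translate_mem hF hSp hSpPs hV)).exists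
  obtain ⟨y, hy⟩ := F.nonempty_of_mem ((Filter.biInter_mem hSp).2 h)
  exact ⟨α, hα, y, fun R hR => Set.mem_iInter₂.1 hy R hR, by simp⟩

theorem hasMonochromatic_of_lower [F.NeBot] (hF : IsIdempotentFilter F)
    (hPs : IsGoodCollection F Ps) (hp : p ∈ filterClosure F) (hL : IsPolyFiltration L N)
    {S : Set (FinSets → G)} (hS : S.Finite) (hSPs : S ⊆ Ps) {P₀ : FinSets → G} (hP₀ : P₀ ∈ S)
    (hrel : ∀ P ∈ S, P * P₀⁻¹ ∈ L 1)
    (hlow : ∀ S' : Set (FinSets → G), S'.Finite → S' ⊆ Ps → ∀ P₀' ∈ S',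
      (∀ P ∈ S', P * P₀'⁻¹ ∈ L 1) →
      weight L N ((· * P₀'⁻¹) '' S') < weight L N ((· * P₀⁻¹) '' S) → HasReturns F Ps p S') :
    HasMonochromatic F Ps S := by
  -- Mappings eventually equal to `P₀` have no level and are set aside; beyond `n₁` they take the
  -- values of `P₀`.
  set S₁ : Set (FinSets → G) := {P | P ∈ S ∧ P * P₀⁻¹ ∉ L N} with hS₁
  have hS₁S : S₁ ⊆ S := fun P h => h.1
  have hS₁fin := hS.subset hS₁S
  have htriv : ∀ᶠ α in eventually, ∀ P ∈ S, P ∉ S₁ → P α = P₀ α := by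
    refine (Filter.eventually_all_finite hS).2 fun P hP => ?_
    by_cases h : P ∈ S₁
    · exact .of_forall fun _ h' => (h' h).elim
    · have h1 := (hL.mem_last _).1 (not_not.1 fun h' => h ⟨hP, h'⟩)
      filter_upwards [h1] with α hα _
      simpa [mul_inv_eq_one] using hα
  have hder : ∀ᶠ δ in eventually, ∀ P ∈ S, ∀ k ∈ Set.Iic N, P * P₀⁻¹ ∈ L k →
      deriv δ (P * P₀⁻¹) ∈ L (k + 1) := by
    refine (Filter.eventually_all_finite hS).2 fun P hP =>
      (Filter.eventually_all_finite (Set.finite_Iic N)).2 fun k _ => ?_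
    by_cases h : P * P₀⁻¹ ∈ L k
    · filter_upwards [hL.deriv_mem k _ h] with δ hδ _ using hδ
    · exact .of_forall fun _ h' => (h h').elim
  obtain ⟨n₁, hn₁⟩ := eventually_iff_exists.1 htriv
  obtain ⟨n₂, hn₂⟩ := eventually_iff_exists.1 hder
  have hmono : HasMonochromatic F Ps (insert P₀ S₁) := by
    refine hasMonochromatic_of_step hF hPs hp hS₁fin (hS₁S.trans hSPs) (hSPs hP₀) n₂
      fun β g Γ hΓ hΓn hmem => ?_
    rcases S₁.eq_empty_or_nonempty with h | hne
    · rw [h, Set.image2_empty_right]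
      exact hasReturns_empty hF hPs
    have hlev : ∀ P : FinSets → G, ∃ k, P ∈ S₁ →
        k < N ∧ P * P₀⁻¹ ∈ L k ∧ P * P₀⁻¹ ∉ L (k + 1) := fun P => by
      by_cases h : P ∈ S₁
      · obtain ⟨k, hk⟩ := exists_level (hrel P h.1) (one_le_of_notMem hL.anti (hrel P h.1) h.2) h.2
        exact ⟨k, fun _ => hk⟩
      · exact ⟨0, fun h' => (h h').elim⟩
    choose lev hlev using hlev
    -- The highest level is the least significant one that occurs in the weight, so removing a class
    -- there disturbs no earlier entry.
    obtain ⟨P₁, hP₁, hmax⟩ := Set.exists_max_image S₁ lev hS₁fin hne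
    have hN : 1 ≤ N := one_le_of_notMem hL.anti (hrel _ hP₁.1) hP₁.2
    have hder' {P : FinSets → G} (hP : P ∈ S₁) {γ : Finset ℕ} (hγ : γ ∈ insert ∅ Γ) {k : ℕ}
        (hk : k ≤ N) (hPk : P * P₀⁻¹ ∈ L k) (h : γ.Nonempty) :
        deriv ⟨γ, h⟩ (P * P₀⁻¹) ∈ L (k + 1) := by
      rcases hγ with rfl | hγ
      · exact (Finset.not_nonempty_empty h).elim
      · exact hn₂ ⟨γ, h⟩ (hΓn γ hγ) P hP.1 k hk hPk
    refine hlow _ ((hΓ.insert _).image2 _ hS₁fin) hmem (focusMap P₀ P₁ ∅ β g)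
      ⟨∅, Set.mem_insert _ _, P₁, hP₁, rfl⟩ ?_ ?_
    · rintro _ ⟨γ, hγ, P, hP, rfl⟩
      have h1 := hL.focusMap_mem (hrel P hP.1) (hrel P₁ hP₁.1) (hrel P₁ hP₁.1)
        (hder' hP hγ hN (hrel P hP.1)) β g
      exact (Subgroup.mul_mem_cancel_left _ (inv_mem (mul_mem (hrel P hP.1)
        (inv_mem (hrel P₁ hP₁.1))))).1 (hL.anti (Nat.le_succ 1) h1)
    · have hsub : (· * P₀⁻¹) '' S₁ ⊆ L 1 := by
        rintro _ ⟨P, hP, rfl⟩; exact hrel P hP.1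
      have hsub' : (· * P₀⁻¹) '' S ⊆ (L 1 : Set (FinSets → G)) := by
        rintro _ ⟨P, hP, rfl⟩; exact hrel P hP
      refine (weight_lt hL (hS₁fin.image _) hsub ⟨P₁, hP₁, rfl⟩ (hlev P₁ hP₁).1 (hlev P₁ hP₁).2.1
        ?_ ?_).trans_le (weight_le hL (hS.image (· * P₀⁻¹)) hsub' ?_)
      · rintro _ ⟨P, hP, rfl⟩ h
        exact (hlev P hP).2.2 (hL.anti (Nat.succ_le_succ (hmax P hP)) h)
      · rintro _ ⟨_, ⟨γ, hγ, P, hP, rfl⟩, rfl⟩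
        exact ⟨_, ⟨P, hP, rfl⟩, fun k hk hPk hP₁k =>
          hL.focusMap_mem hPk hP₁k (hrel P₁ hP₁.1) (hder' hP hγ hk hPk) β g⟩
      · rintro _ ⟨P, hP, rfl⟩
        exact ⟨_, ⟨P, hS₁S hP, rfl⟩, fun k _ => by rw [inv_mul_cancel]; exact one_mem _⟩
  intro ι _ χ Sp hSp hSpPs V hV n
  obtain ⟨α, hα, h, hR, c, hc⟩ := hmono ι χ Sp hSp hSpPs V hV (max n n₁)
  refine ⟨α, tail_antitone (le_max_left _ _) hα, h, hR, c, fun P hP => ?_⟩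
  by_cases h1 : P ∈ S₁
  · exact hc P (Or.inr h1)
  · rw [hn₁ α (tail_antitone (le_max_right _ _) hα) P hP h1]
    exact hc P₀ (Or.inl rfl)

theorem hasReturns [F.NeBot] (hF : IsIdempotentFilter F) (hPs : IsGoodCollection F Ps)
    (hp : p ∈ minimalElements (filterClosure F)) (hL : IsPolyFiltration L N)
    {S : Set (FinSets → G)} (hS : S.Finite) (hSPs : S ⊆ Ps) {P₀ : FinSets → G} (hP₀ : P₀ ∈ S)
    (hrel : ∀ P ∈ S, P * P₀⁻¹ ∈ L 1) : HasReturns F Ps p S := by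
  induction hw : weight L N ((· * P₀⁻¹) '' S) using WellFoundedLT.induction generalizing S P₀ with
  | ind w ih =>
    subst hw
    refine hasReturns_of_hasMonochromatic hF hPs hp hS hSPs hP₀ fun K hK hKne hsub => ?_
    obtain ⟨k₀, hk₀⟩ := hKne
    have htw (k : G) (P : FinSets → G) :
        twist P₀ k P * P₀⁻¹ = conj (P * P₀⁻¹) (Function.const _ k) := by
      ext α
      simp only [twist, conj, comm, Pi.mul_apply, Pi.inv_apply, Function.const_apply]
      group
    refine hasMonochromatic_of_lower hF hPs hp.1 hL (hK.image2 _ hS) hsub (P₀ := P₀)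
      ⟨k₀, hk₀, P₀, hP₀, twist_self P₀ k₀⟩ ?_ fun S' hS' hS'Ps P₀' hP₀' hrel' hlt =>
        ih _ (hlt.trans_le ?_) hS' hS'Ps hP₀' hrel' rfl
    · rintro _ ⟨k, hk, P, hP, rfl⟩
      rw [htw, conj_eq_mul_comm]
      exact mul_mem (hrel P hP) (hL.anti (Nat.le_succ 1) (hL.comm_const_mem 1 _ (hrel P hP) k))
    · refine weight_le hL (hS.image _) (by rintro _ ⟨P, hP, rfl⟩; exact hrel P hP) ?_
      rintro _ ⟨_, ⟨k, hk, P, hP, rfl⟩, rfl⟩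
      refine ⟨_, ⟨P, hP, rfl⟩, fun l hl => ?_⟩
      simp only [htw]
      exact hL.inv_mul_conj_mem hl k

end Induction

/-! ### Deduction of the two parts of the theorem. -/

theorem exists_forall_mul_mem [Group.IsNilpotent G] (F : Filter G) [F.NeBot]
    (hF : IsIdempotentFilter F) {Ps : Set (FinSets → G)} (hPs : IsGoodCollection F Ps) {k : ℕ}
    (P : Fin k → FinSets → G) (hP : ∀ i, P i ∈ Ps) (A : Set G)
    (hA : IsFilterSyndetic F A ∨ IsPiecewiseFilterSyndetic F A) :
    ∃ (α : FinSets) (a : G), ∀ i, P i α * a ∈ A := by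
  obtain ⟨p, hp, hAp⟩ : ∃ p ∈ minimalElements (filterClosure F), A ∈ p := by
    rcases hA with hA | ⟨p, hp, hAp⟩
    · exact hA.exists_minimalElement hF
    · exact ⟨p, smallestIdeal_subset_minimalElements hF hp, hAp⟩
  -- The constant `1` serves as `P₀`, so that the quotients `P * P₀⁻¹` are the given mappings.
  have hS : (insert 1 (Set.range P)).Finite := (Set.finite_range P).insert _
  have hSPs : insert 1 (Set.range P) ⊆ Ps :=
    Set.insert_subset hPs.one_mem (Set.range_subset_iff.2 hP)
  obtain ⟨L, N, hL, hSL, -⟩ := exists_isPolyFiltration hS fun P hP => hPs.isPoly P (hSPs hP)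
  obtain ⟨α, -, h, -, hh⟩ := hasReturns hF hPs hp hL hS hSPs (Set.mem_insert _ _)
    (fun P hP => by simpa using hSL hP) ∅ Set.finite_empty (Set.empty_subset _) A hAp Set.univ
    Filter.univ_mem 0
  have : ∀ᶠ y in (p : Filter G), ∀ i, P i α * h * y ∈ A :=
    Filter.eventually_all.2 fun i => hh _ (Or.inr ⟨i, rfl⟩)
  obtain ⟨y, hy⟩ := this.exists
  exact ⟨α, h * y, fun i => mul_assoc (P i α) h y ▸ hy i⟩

theorem isIdempotentFilter_top : IsIdempotentFilter (⊤ : Filter G) := by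
  intro A hA
  rw [Filter.mem_top] at hA
  subst hA
  exact Filter.univ_mem

/-- For the trivial filter the whole group `L 1` is good: derivatives and commutators with constants
even land in `L 2`. -/
theorem IsPolyFiltration.isGoodCollection {L : ℕ → Subgroup (FinSets → G)} {N : ℕ}
    (hL : IsPolyFiltration L N) (hpoly : ∀ Q ∈ L 1, IsPoly Q) :
    IsGoodCollection (⊤ : Filter G) (L 1 : Set (FinSets → G)) where
  isPoly := hpoly
  one_mem := one_mem (L 1)
  measurable := fun P _ V hV => by
    rw [Filter.mem_top.1 hV]
    simp
  conj_comm_mem := fun R hR P hP => Filter.mem_top.2 <| Set.eq_univ_of_forall fun c => by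
    have h2 := Nat.le_succ 1
    have h := mul_mem (mul_mem hR (hL.anti h2 (hL.comm_const_mem 1 R hR c)))
      (inv_mem (hL.anti h2 (hL.comm_const_mem 1 P hP c)))
    rw [← conj_eq_mul_comm, ← comm_swap] at h
    exact h
  conj_deriv_mem := fun R hR P hP => by
    refine ⟨Set.univ, Filter.univ_mem, _, hL.deriv_mem 1 P hP, fun c _ β hβ => ?_⟩
    have h2 := Nat.le_succ 1
    have h1 : R * deriv β P ∈ L 1 := mul_mem hR (hL.anti h2 hβ)
    have h := mul_mem h1 (hL.anti h2 (hL.comm_const_mem 1 _ h1 c))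
    rw [← conj_eq_mul_comm] at h
    exact h

end NilpotentPHJ


theorem mainTheorem1 {G : Type*} [Group G] [Group.IsNilpotent G] :
    (∀ (F : Filter G) [F.NeBot], NilpotentPHJ.IsIdempotentFilter F →
      ∀ Ps : Set (NilpotentPHJ.FinSets → G), NilpotentPHJ.IsGoodCollection F Ps →
      ∀ (k : ℕ) (P : Fin k → NilpotentPHJ.FinSets → G), (∀ i, P i ∈ Ps) →
      ∀ A : Set G,
        (NilpotentPHJ.IsFilterSyndetic F A ∨ NilpotentPHJ.IsPiecewiseFilterSyndetic F A) →
        ∃ (α : NilpotentPHJ.FinSets) (a : G), ∀ i, P i α * a ∈ A) ∧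
    (∀ (k : ℕ) (P : Fin k → NilpotentPHJ.FinSets → G), (∀ i, NilpotentPHJ.IsPoly (P i)) →
      ∀ A : Set G, NilpotentPHJ.IsSyndetic A →
        ∃ (α : NilpotentPHJ.FinSets) (a : G), ∀ i, P i α * a ∈ A) := by
  refine ⟨fun F _ hF Ps hPs k P hP A hA =>
    NilpotentPHJ.exists_forall_mul_mem F hF hPs P hP A hA, fun k P hP A hA => ?_⟩
  obtain ⟨L, N, hL, hPL, hpoly⟩ := NilpotentPHJ.exists_isPolyFiltration (Set.finite_range P)
    (Set.forall_mem_range.2 hP)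
  refine NilpotentPHJ.exists_forall_mul_mem ⊤ NilpotentPHJ.isIdempotentFilter_top
    (hL.isGoodCollection hpoly) P (fun i => hPL ⟨i, rfl⟩) A (Or.inl fun V hV => ?_)
  obtain ⟨K, hK, hKA⟩ := hA
  rw [Filter.mem_top.1 hV]
  exact ⟨K, hK, Set.subset_univ _, hKA ▸ Filter.univ_mem⟩
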